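/- Let $1<p<3$ and let $V:\mathbb R^2\to\mathbb R$ satisfy $0\le V\in L^\infty_{loc}(\mathbb R^2)$ and $\liminf_{|x|\to\infty}V(x)/|x|^2>0$. Put $x^\perp=(-x_2,x_1)$, $(iu,\nabla u)=\tfrac i2(u\nabla\bar u-\bar u\nabla u)$, $$\Omega^*:=\sup\{\Omega>0:\ V(x)-\tfrac{\Omega^2}{4}|x|^2\to\infty\text{ as }|x|\to\infty\}\in(0,\infty],$$ and $\mathcal H:=\{u\in H^1(\mathbb R^2,\mathbb C):\int_{\mathbb R^2}V|u|^2dx<\infty\}$. Let $\rho>0$ and $0<\Omega<\Omega^*$. For $u\in\mathcal H$ and $\mu\in\mathbb R$ let $$E_\rho(u)=\int_{\mathbb R^2}(|\nabla u|^2+V|u|^2)\,dx-\frac{2\rho^{p-1}}{p+1}\int_{\mathbb R^2}|u|^{p+1}dx-\Omega\int_{\mathbb R^2}x^\perp\cdot(iu,\nabla u)\,dx,$$ $$F_{\mu,\rho}(u)=\int_{\mathbb R^2}(|\nabla u|^2+(V-\mu)|u|^2)\,dx-\frac{2\rho^{p-1}}{p+1}\int_{\mathbb R^2}|u|^{p+1}dx-\Omega\int_{\mathbb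 R^2}x^\perp\cdot(iu,\nabla u)\,dx,$$ and $I(\rho)=\inf\{E_\rho(u):u\in\mathcal H,\ \|u\|_2^2=1\}$; a minimizer of $I(\rho)$ is a function that attains this infimum. Let $S_{\mu,\rho}$ be the set of all $u\in\mathcal H\setminus\{0\}$ such that for all $\varphi\in\mathcal H$ $$2\,\mathrm{Re}\Big\{\int_{\mathbb R^2}\big[\nabla u\cdot\nabla\bar\varphi+(V-\mu)u\bar\varphi\big]dx-\rho^{p-1}\int_{\mathbb R^2}|u|^{p-1}u\bar\varphi\,dx+\int_{\mathbb R^2}i\Omega(x^\perp\cdot\nabla u)\bar\varphi\,dx\Big\}=0,$$ that is, the set of nontrivial weak solutions of $$-\Delta u+Vu+i\Omega(x^\perp\cdot\nabla u)=\mu u+\rho^{p-1}|u|^{p-1}u\quad\text{in }\mathbb R^2,$$ and let $G_{\mu,\rho}=\{u\in S_{\mu,\rho}:F_{\mu,\rho}(u)\le F_{\mu,\rho}(v)\text{ for all }v\in S_{\mu,\rho}\}$ be the set of ground states of this equation for $\mu$. Then: (1) every minimizer of $I(\rho)$ belongs to $G_{\mu,\rho}$ for some $\mu\in\mathbb R$;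 (2) conversely, for each chemical potential $\mu$ of $I(\rho)$, i.e. each $\mu\in\mathbb R$ such that some minimizer of $I(\rho)$ belongs to $S_{\mu,\rho}$, every ground state $u\in G_{\mu,\rho}$ is a minimizer of $I(\rho)$ (in particular $\|u\|_2=1$). -/

import Mathlib

open MeasureTheory Filter Topology
open scoped ContDiff ENNReal

noncomputable section

namespace RotNLS

/-- The plane with its Euclidean norm and Lebesgue measure. -/
abbrev Plane : Type := EuclideanSpace ℝ (Fin 2)

/-- The filter of sets that contain almost every point outside some compact set: it expresses
`|x| → ∞` for functions, such as elements of `L^∞_loc`, that are determined almost everywhere. -/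
def atInfinity : Filter Plane := cocompact Plane ⊓ ae (volume : Measure Plane)

/-- The standing assumptions on the potential: `0 ≤ V ∈ L^∞_loc(ℝ²)` and
`liminf_{|x| → ∞} V(x) / |x|² > 0`. -/
structure IsTrapping (V : Plane → ℝ) : Prop where
  nonneg : ∀ᵐ x, 0 ≤ V x
  locallyBounded : ∀ K : Set Plane, IsCompact K → MemLp V ∞ (volume.restrict K)
  growth : (0 : EReal) < liminf (fun x => ((V x / ‖x‖ ^ 2 : ℝ) : EReal)) atInfinity

/-- The critical rotational speed
`Ω* = sup {Ω > 0 : V(x) - (Ω² / 4) |x|² → ∞ as |x| → ∞}`, possibly `+∞`. -/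
def criticalSpeed (V : Plane → ℝ) : EReal :=
  sSup ((fun Ω : ℝ => (Ω : EReal)) ''
    {Ω : ℝ | 0 < Ω ∧ Tendsto (fun x => V x - Ω ^ 2 / 4 * ‖x‖ ^ 2) atInfinity atTop})

/-- `g` is the `j`-th partial derivative of `u` in the sense of distributions
(used below for `u` and `g` in `L²`). -/
def IsWeakPartial (j : Fin 2) (u g : Plane → ℂ) : Prop :=
  ∀ φ : Plane → ℝ, ContDiff ℝ ∞ φ → HasCompactSupport φ →
    ∫ x, (fderiv ℝ φ x (EuclideanSpace.single j 1)) • u x = -∫ x, φ x • g x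

/-- `u` has a `j`-th weak partial derivative in `L²`. -/
def HasL2Partial (j : Fin 2) (u : Plane → ℂ) : Prop :=
  ∃ g : Plane → ℂ, MemLp g 2 ∧ IsWeakPartial j u g

open Classical in
/-- The `j`-th weak partial derivative of `u` (unique up to a null set when it exists). -/
def weakPartial (j : Fin 2) (u : Plane → ℂ) : Plane → ℂ :=
  if h : HasL2Partial j u then h.choose else 0

/-- (Representatives of) elements of the Sobolev space `H¹(ℝ², ℂ)`. -/
def MemH1 (u : Plane → ℂ) : Prop :=
  MemLp u 2 ∧ ∀ j, HasL2Partial j u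

/-- The energy space `𝓗 = {u ∈ H¹(ℝ², ℂ) : ∫ V |u|² < ∞}` (as representatives). -/
def energySpace (V : Plane → ℝ) : Set (Plane → ℂ) :=
  {u | MemH1 u ∧ Integrable (fun x => V x * ‖u x‖ ^ 2)}

/-- `x^⊥ = (-x₂, x₁)`. -/
def perp (x : Plane) : Plane := !₂[-x 1, x 0]

/-- `|∇u|²`. -/
def gradSq (u : Plane → ℂ) (x : Plane) : ℝ := ∑ j, ‖weakPartial j u x‖ ^ 2

/-- `x^⊥ · ∇u`. -/
def rotDeriv (u : Plane → ℂ) (x : Plane) : ℂ := ∑ j, (perp x j : ℂ) * weakPartial j u x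

/-- `∇u · ∇φ̄`. -/
def gradPairing (u φ : Plane → ℂ) (x : Plane) : ℂ :=
  ∑ j, weakPartial j u x * star (weakPartial j φ x)

/-- The `j`-th component of the vector field `(iu, ∇u) = i (u ∇ū - ū ∇u) / 2`, which is real. -/
def current (u : Plane → ℂ) (j : Fin 2) (x : Plane) : ℝ :=
  (Complex.I * (u x * star (weakPartial j u x) - star (u x) * weakPartial j u x) / 2).re

/-- `x^⊥ · (iu, ∇u)`. -/
def rotDensity (u : Plane → ℂ) (x : Plane) : ℝ := ∑ j, perp x j * current u j x

/-- The Gross-Pitaevskii energy `E_ρ`. -/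
def energy (V : Plane → ℝ) (p Ω ρ : ℝ) (u : Plane → ℂ) : ℝ :=
  (∫ x, (gradSq u x + V x * ‖u x‖ ^ 2))
    - 2 * ρ ^ (p - 1) / (p + 1) * (∫ x, ‖u x‖ ^ (p + 1))
    - Ω * (∫ x, rotDensity u x)

/-- The constraint set `{u ∈ 𝓗 : ‖u‖₂² = 1}`. -/
def unitMass (V : Plane → ℝ) : Set (Plane → ℂ) :=
  {u | u ∈ energySpace V ∧ ∫ x, ‖u x‖ ^ 2 = 1}

/-- `u` is a minimizer of `I(ρ) = inf {E_ρ(u) : u ∈ 𝓗, ‖u‖₂² = 1}`. -/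
def IsMinimizer (V : Plane → ℝ) (p Ω ρ : ℝ) (u : Plane → ℂ) : Prop :=
  u ∈ unitMass V ∧ IsMinOn (energy V p Ω ρ) (unitMass V) u

/-- The functional `F_{μ,ρ}` of the rotating nonlinear Schrödinger equation. -/
def action (V : Plane → ℝ) (p Ω ρ μ : ℝ) (u : Plane → ℂ) : ℝ :=
  (∫ x, (gradSq u x + (V x - μ) * ‖u x‖ ^ 2))
    - 2 * ρ ^ (p - 1) / (p + 1) * (∫ x, ‖u x‖ ^ (p + 1))
    - Ω * (∫ x, rotDensity u x)

/-- The pairing `⟨F'_{μ,ρ}(u), φ⟩`. -/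
def actionDeriv (V : Plane → ℝ) (p Ω ρ μ : ℝ) (u φ : Plane → ℂ) : ℝ :=
  2 * ((∫ x, (gradPairing u φ x + ((V x - μ : ℝ) : ℂ) * u x * star (φ x)))
    - ((ρ ^ (p - 1) : ℝ) : ℂ) * (∫ x, ((‖u x‖ ^ (p - 1) : ℝ) : ℂ) * u x * star (φ x))
    + ∫ x, Complex.I * (Ω : ℂ) * rotDeriv u x * star (φ x)).re

/-- The set `S_{μ,ρ}` of nontrivial critical points of `F_{μ,ρ}` in `𝓗`, that is, of nontrivial
weak solutions of `-Δu + V u + i Ω (x^⊥ · ∇u) = μ u + ρ^(p-1) |u|^(p-1) u`. -/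
def criticalPoints (V : Plane → ℝ) (p Ω ρ μ : ℝ) : Set (Plane → ℂ) :=
  {u | u ∈ energySpace V ∧ ¬ (u =ᵐ[volume] 0) ∧
    ∀ φ ∈ energySpace V, actionDeriv V p Ω ρ μ u φ = 0}

/-- The set `G_{μ,ρ}` of ground states: critical points of least action. -/
def groundStates (V : Plane → ℝ) (p Ω ρ μ : ℝ) : Set (Plane → ℂ) :=
  {u | u ∈ criticalPoints V p Ω ρ μ ∧
    ∀ v ∈ criticalPoints V p Ω ρ μ, action V p Ω ρ μ u ≤ action V p Ω ρ μ v}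

/-- `μ` is a chemical potential of the problem `I(ρ)`: some minimizer of `I(ρ)` solves the
equation with this `μ`. -/
def IsChemicalPotential (V : Plane → ℝ) (p Ω ρ μ : ℝ) : Prop :=
  ∃ u, IsMinimizer V p Ω ρ u ∧ u ∈ criticalPoints V p Ω ρ μ

end RotNLS

end

/-!
Write `A(u) = ∫ (|∇u|² + V |u|²) - Ω ∫ x^⊥ · (iu, ∇u)`, `M(u) = ∫ |u|²`, `N(u) = ∫ |u|^(p+1)` and
`k = ρ^(p-1)`, so that `E = A - 2 k N / (p + 1)` and `F_μ = E - μ M`.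

A critical point `v` of `F_μ`, tested against itself, satisfies `A(v) - μ M(v) = k N(v)`, whence
`F_μ(s v) = k N(v) (s² - 2 s^(p+1) / (p + 1))` for `s > 0`. Since `N(v) > 0` and `p > 1`, this is
maximal exactly at `s = 1` (`action_smul_lt`, from Bernoulli's inequality). For `s = ‖v‖₂⁻¹` the
function `s v` competes in `I(ρ)`, so that a minimizer `u` satisfies
`F_μ(u) = I(ρ) - μ ≤ F_μ(s v) ≤ F_μ(v)`, with strict inequality unless `‖v‖₂ = 1`
(`action_le_of_isMinimizer`). Hence a minimizer which solves the equation for `μ` is a ground state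
for `μ`, and any other ground state for this `μ` has unit mass and the same energy.

That every minimizer solves the equation for some `μ` (`IsMinimizer.mem_criticalPoints`) follows by
differentiating the energy of the normalized function `(u + t φ) / ‖u + t φ‖₂` at `t = 0`; this
gives the multiplier `μ = A(u) - k N(u)` explicitly.

Two analytic facts enter. First, `N` is finite and differentiable on `H¹(ℝ²)`, because
`H¹(ℝ²) ⊆ L⁴(ℝ²)` (Ladyzhenskaya): for a test function `w` this is the Gagliardo-Nirenberg-Sobolev
inequality for `w²`, and the general case follows by density (`memLp_mul_self_of_weakPartial`).
Secondly, the derivative of the rotation term has the form that occurs in the equation only because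
`Im ∫ (x^⊥ · ∇u) φ̄` is symmetric in `u` and `φ` (`integral_rotDeriv_symm`), an integration by parts
that uses `|x| u ∈ L²`, a consequence of the quadratic growth of `V`. Both facts rest on the density
of test functions in `H¹`, which is obtained by mollification and truncation
(`exists_smooth_approx`).
-/

namespace RotNLS

/-! ### Translations and weighted means in `L²` -/

theorem tendsto_eLpNorm_translate_sub {f : Plane → ℂ} (hf : MemLp f 2) :
    Tendsto (fun y : Plane => eLpNorm (fun x => f (x - y) - f x) 2) (𝓝 0) (𝓝 0) := by
  let g : C(Plane, C(Plane, Plane)) :=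
    ContinuousMap.curry ⟨fun q : Plane × Plane => q.2 - q.1, by fun_prop⟩
  have hg : ∀ y, MeasurePreserving (g y) (volume : Measure Plane) volume := fun y =>
    measurePreserving_sub_right volume y
  have h := (Continuous.compMeasurePreservingLp (continuous_const (y := hf.toLp f)) g.continuous hg
    (by simp)).tendsto 0
  rw [Lp.tendsto_Lp_iff_tendsto_eLpNorm'] at h
  refine h.congr fun y => eLpNorm_congr_ae ?_
  have h1 : ∀ z, Lp.compMeasurePreserving (g z) (hg z) (hf.toLp f) =ᵐ[volume]
      fun x => f (x - z) := fun z =>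
    (Lp.coeFn_compMeasurePreserving _ _).trans
      ((hg z).quasiMeasurePreserving.ae_eq_comp hf.coeFn_toLp)
  filter_upwards [h1 y, h1 0] with x hx hx0
  rw [Pi.sub_apply, hx, hx0, sub_zero]

/-- Jensen's inequality for the square and a probability density `w`. The right-hand side may be
infinite, and `F` need not be integrable. -/
theorem sq_enorm_integral_smul_le {α : Type*} [MeasurableSpace α] {m : Measure α} {w : α → ℝ}
    (hw : ∀ y, 0 ≤ w y) (hwm : Measurable w) (hw1 : ∫⁻ y, ENNReal.ofReal (w y) ∂m = 1)
    {F : α → ℂ} (hF : AEStronglyMeasurable F m) :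
    ‖∫ y, w y • F y ∂m‖ₑ ^ 2 ≤ ∫⁻ y, ENNReal.ofReal (w y) * ‖F y‖ₑ ^ 2 ∂m := by
  have hmeas : Measurable fun y => ENNReal.ofReal (w y) := hwm.ennreal_ofReal
  let ν : Measure α := m.withDensity fun y => ENNReal.ofReal (w y)
  have : IsProbabilityMeasure ν := ⟨by simpa [ν] using hw1⟩
  have hFν : AEStronglyMeasurable F ν := hF.mono_ac (withDensity_absolutelyContinuous _ _)
  have h2 : ∫⁻ y, ENNReal.ofReal (w y) * ‖F y‖ₑ ^ 2 ∂m = ∫⁻ y, ‖F y‖ₑ ^ 2 ∂ν := by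
    rw [lintegral_withDensity_eq_lintegral_mul₀' hmeas.aemeasurable (hFν.enorm.pow_const 2)]
    rfl
  have h1 : ∫ y, w y • F y ∂m = ∫ y, F y ∂ν := by
    rw [integral_withDensity_eq_integral_toReal_smul hmeas (by simp)]
    simp [ENNReal.toReal_ofReal, hw]
  rw [h1, h2]
  have h3 := eLpNorm_le_eLpNorm_of_exponent_le (p := 1) (q := 2) (by norm_num) hFν
  have h4 : ‖∫ y, F y ∂ν‖ₑ ≤ eLpNorm F 2 ν :=
    (enorm_integral_le_lintegral_enorm F).trans (by rwa [← eLpNorm_one_eq_lintegral_enorm])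
  refine (pow_le_pow_left' h4 2).trans ?_
  have h5 := eLpNorm_nnreal_pow_eq_lintegral (f := F) (μ := ν) (p := 2) (by norm_num)
  simp only [NNReal.coe_ofNat, ENNReal.coe_ofNat, ENNReal.rpow_ofNat] at h5
  exact h5.le

theorem eLpNorm_two_sq {f : Plane → ℂ} : eLpNorm f 2 ^ 2 = ∫⁻ x, ‖f x‖ₑ ^ 2 := by
  have h5 := eLpNorm_nnreal_pow_eq_lintegral (f := f) (μ := volume) (p := 2) (by norm_num)
  simpa only [NNReal.coe_ofNat, ENNReal.coe_ofNat, ENNReal.rpow_ofNat] using h5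

/-! ### Mollification and cutoff functions -/

open scoped Convolution

theorem convolution_sub_apply (η : ContDiffBump (0 : Plane)) {f : Plane → ℂ}
    (hf : LocallyIntegrable f) (x : Plane) :
    (η.normed volume ⋆[ContinuousLinearMap.lsmul ℝ ℝ, volume] f) x - f x
      = ∫ y, η.normed volume y • (f (x - y) - f x) := by
  have h1 : Integrable (fun y => η.normed volume y • f (x - y)) :=
    η.hasCompactSupport_normed.convolutionExists_left (ContinuousLinearMap.lsmul ℝ ℝ)
      η.continuous_normed hf x
  have h2 : Integrable (fun y => η.normed volume y • f x) :=
    η.integrable_normed.smul_const (f x)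
  simp_rw [smul_sub]
  rw [integral_sub h1 h2, integral_smul_const, η.integral_normed, one_smul]
  rfl

/-- A mollification differs from `f` in `L²` by at most the largest `L²` distance between `f` and
its translates by vectors in the support of the bump: apply Jensen's inequality for the measure
`η dy`, and exchange the integrals. -/
theorem eLpNorm_convolution_sub_le (η : ContDiffBump (0 : Plane)) {f : Plane → ℂ}
    (hf : MemLp f 2) {ε : ℝ≥0∞}
    (hε : ∀ y ∈ Metric.ball (0 : Plane) η.rOut, eLpNorm (fun x => f (x - y) - f x) 2 ≤ ε) :
    eLpNorm (fun x => (η.normed volume ⋆[ContinuousLinearMap.lsmul ℝ ℝ, volume] f) x - f x) 2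
      ≤ ε := by
  have hloc : LocallyIntegrable f := hf.locallyIntegrable (by norm_num)
  rw [← ENNReal.pow_le_pow_left_iff two_ne_zero, eLpNorm_two_sq]
  have hw1 : ∫⁻ y, ENNReal.ofReal (η.normed volume y) = 1 := by
    rw [← ofReal_integral_eq_lintegral_ofReal η.integrable_normed
      (Eventually.of_forall η.nonneg_normed), η.integral_normed, ENNReal.ofReal_one]
  have hwm : Measurable (η.normed volume) := η.continuous_normed.measurable
  have hshift : AEStronglyMeasurable (fun q : Plane × Plane => f (q.1 - q.2) - f q.1)
      (volume.prod volume) := by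
    refine AEStronglyMeasurable.sub ?_ ?_
    · exact hf.1.comp_quasiMeasurePreserving
        (quasiMeasurePreserving_sub_of_right_invariant volume volume)
    · exact hf.1.comp_fst
  calc ∫⁻ x, ‖(η.normed volume ⋆[ContinuousLinearMap.lsmul ℝ ℝ, volume] f) x - f x‖ₑ ^ 2
      ≤ ∫⁻ x, ∫⁻ y, ENNReal.ofReal (η.normed volume y) * ‖f (x - y) - f x‖ₑ ^ 2 := by
        refine lintegral_mono fun x => ?_
        rw [convolution_sub_apply η hloc]
        refine sq_enorm_integral_smul_le η.nonneg_normed hwm hw1 ?_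
        refine AEStronglyMeasurable.sub ?_ aestronglyMeasurable_const
        exact hf.1.comp_quasiMeasurePreserving
          (quasiMeasurePreserving_sub_left_of_right_invariant volume x)
    _ = ∫⁻ y, ∫⁻ x, ENNReal.ofReal (η.normed volume y) * ‖f (x - y) - f x‖ₑ ^ 2 := by
        refine lintegral_lintegral_swap ?_
        exact (hwm.ennreal_ofReal.comp measurable_snd).aemeasurable.mul (hshift.enorm.pow_const 2)
    _ ≤ ∫⁻ y, ENNReal.ofReal (η.normed volume y) * ε ^ 2 := by
        refine lintegral_mono fun y => ?_
        rw [lintegral_const_mul' _ _ ENNReal.ofReal_ne_top, ← eLpNorm_two_sq]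
        by_cases hy : y ∈ Metric.ball (0 : Plane) η.rOut
        · gcongr
          exact hε y hy
        · have : η.normed volume y = 0 := by
            rw [← Function.notMem_support, η.support_normed_eq]
            exact hy
          simp [this]
    _ = ε ^ 2 := by
        rw [lintegral_mul_const _ hwm.ennreal_ofReal, hw1, one_mul]

/-- The direction of the `j`-th coordinate axis. -/
noncomputable abbrev axis (j : Fin 2) : Plane := EuclideanSpace.single j 1

theorem contDiff_mollify (η : ContDiffBump (0 : Plane)) {f : Plane → ℂ}
    (hf : LocallyIntegrable f) :
    ContDiff ℝ ∞ (η.normed volume ⋆[ContinuousLinearMap.lsmul ℝ ℝ, volume] f) :=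
  η.hasCompactSupport_normed.contDiff_convolution_left _ η.contDiff_normed hf

/-- The derivative falls on the bump `y ↦ η (x - y)`, which is an admissible test function in the
definition of the weak derivative. -/
theorem fderiv_mollify (η : ContDiffBump (0 : Plane)) {f g : Plane → ℂ}
    (hf : LocallyIntegrable f) {j : Fin 2} (hg : IsWeakPartial j f g) (x : Plane) :
    fderiv ℝ (η.normed volume ⋆[ContinuousLinearMap.lsmul ℝ ℝ, volume] f) x (axis j)
      = (η.normed volume ⋆[ContinuousLinearMap.lsmul ℝ ℝ, volume] g) x := by
  have hη : ContDiff ℝ ∞ (η.normed volume) := η.contDiff_normed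
  have hcs : HasCompactSupport (η.normed (volume : Measure Plane)) := η.hasCompactSupport_normed
  have h1 := hcs.hasFDerivAt_convolution_left (μ := volume)
    (ContinuousLinearMap.lsmul ℝ ℝ) (hη.of_le (by simp)) hf x
  have hint : Integrable fun t => (ContinuousLinearMap.lsmul ℝ ℝ).precompL Plane
      (fderiv ℝ (η.normed volume) t) (f (x - t)) :=
    (hcs.fderiv ℝ).convolutionExists_left _ (hη.continuous_fderiv (by simp)) hf x
  let φ : Plane → ℝ := fun t => η.normed volume (x - t)
  have hφd : ∀ t, fderiv ℝ φ t (axis j) = -fderiv ℝ (η.normed volume) (x - t) (axis j) := by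
    intro t
    have := (((hη.differentiable (by simp)) (x - t)).hasFDerivAt.comp t
      ((hasFDerivAt_id t).const_sub x)).fderiv
    change fderiv ℝ (η.normed volume ∘ HSub.hSub x) t (axis j) = _
    rw [this]
    simp
  have hφ := hg φ (hη.comp (contDiff_const.sub contDiff_id))
    (hcs.comp_homeomorph (Homeomorph.subLeft x))
  rw [h1.fderiv, convolution_def, ContinuousLinearMap.integral_apply hint, convolution_def,
    ← integral_sub_left_eq_self _ volume x, ← integral_sub_left_eq_self
      (fun t => ContinuousLinearMap.lsmul ℝ ℝ (η.normed volume t) (g (x - t))) volume x]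
  simp only [hφd, neg_smul, integral_neg, neg_inj, φ] at hφ
  simpa using hφ

/-- Cutoff functions `χₙ`, dilations of one bump function: `|χₙ| ≤ 1`, at each point `χₙ = 1` for
large `n`, and the partial derivatives are uniformly `O(1 / n)`. -/
theorem exists_cutoff : ∃ (χ : ℕ → Plane → ℝ) (C : ℝ), (∀ n, ContDiff ℝ ∞ (χ n)) ∧
    (∀ n, HasCompactSupport (χ n)) ∧ (∀ n x, |χ n x| ≤ 1) ∧
    (∀ x, ∀ᶠ n in atTop, χ n x = 1) ∧
    (∀ n x j, |fderiv ℝ (χ n) x (axis j)| ≤ C * ((n : ℝ) + 1)⁻¹) := by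
  let b : ContDiffBump (0 : Plane) := ⟨1, 2, one_pos, one_lt_two⟩
  have hb : ContDiff ℝ ∞ b := b.contDiff
  obtain ⟨C, hC⟩ := (b.hasCompactSupport.fderiv ℝ).exists_bound_of_continuous
    (hb.continuous_fderiv (by simp))
  refine ⟨fun n x => b (((n : ℝ) + 1)⁻¹ • x), C, fun n => ?_, fun n => ?_, fun n x => ?_,
    fun x => ?_, fun n x j => ?_⟩
  · exact hb.comp (contDiff_const_smul _)
  · exact b.hasCompactSupport.comp_smul (by positivity)
  · rw [abs_of_nonneg b.nonneg]
    exact b.le_one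
  · have : Tendsto (fun n : ℕ => ((n : ℝ) + 1)⁻¹ • x) atTop (𝓝 ((0 : ℝ) • x)) :=
      (tendsto_inv_atTop_zero.comp
        (tendsto_atTop_add_const_right _ 1 tendsto_natCast_atTop_atTop)).smul_const x
    rw [zero_smul] at this
    filter_upwards [this (Metric.closedBall_mem_nhds (0 : Plane) one_pos)] with n hn
    exact b.one_of_mem_closedBall hn
  · have h := (((hb.differentiable (by simp)) (((n : ℝ) + 1)⁻¹ • x)).hasFDerivAt.comp x
      ((hasFDerivAt_id x).const_smul (((n : ℝ) + 1)⁻¹))).fderiv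
    change |fderiv ℝ (b ∘ HSMul.hSMul ((n : ℝ) + 1)⁻¹) x (axis j)| ≤ _
    rw [h]
    have h1 : (0 : ℝ) ≤ ((n : ℝ) + 1)⁻¹ := by positivity
    have h2 := (fderiv ℝ b (((n : ℝ) + 1)⁻¹ • x)).le_opNorm (axis j)
    rw [Real.norm_eq_abs] at h2
    simp only [PiLp.norm_single, norm_one, mul_one] at h2
    simp only [ContinuousLinearMap.comp_apply, smul_apply,
      ContinuousLinearMap.id_apply, map_smul, smul_eq_mul, abs_mul, abs_of_nonneg h1]
    rw [mul_comm]
    gcongr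
    exact h2.trans (hC _)

/-! ### Density of test functions in `H¹` -/

/-- Bump functions of integral one (after normalization) whose supports shrink to the origin. -/
noncomputable def mollifier (n : ℕ) : ContDiffBump (0 : Plane) :=
  ⟨((n : ℝ) + 1)⁻¹ / 2, ((n : ℝ) + 1)⁻¹, by positivity, half_lt_self (by positivity)⟩

/-- The mollification of `f` at scale `1 / (n + 1)`. -/
noncomputable def mollify (n : ℕ) (f : Plane → ℂ) : Plane → ℂ :=
  (mollifier n).normed volume ⋆[ContinuousLinearMap.lsmul ℝ ℝ, volume] f

theorem tendsto_eLpNorm_mollify_sub {f : Plane → ℂ} (hf : MemLp f 2) :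
    Tendsto (fun n => eLpNorm (fun x => mollify n f x - f x) 2) atTop (𝓝 0) := by
  rw [ENNReal.tendsto_nhds_zero]
  intro ε hε
  obtain ⟨r, hr, hball⟩ := Metric.eventually_nhds_iff_ball.1
    (ENNReal.tendsto_nhds_zero.1 (tendsto_eLpNorm_translate_sub hf) ε hε)
  have h0 : Tendsto (fun n : ℕ => ((n : ℝ) + 1)⁻¹) atTop (𝓝 0) :=
    tendsto_inv_atTop_zero.comp
      (tendsto_atTop_add_const_right _ 1 tendsto_natCast_atTop_atTop)
  filter_upwards [h0.eventually_lt_const hr] with n hn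
  exact eLpNorm_convolution_sub_le _ hf fun y hy =>
    hball y (Metric.ball_subset_ball (le_of_lt hn) hy)

theorem tendsto_eLpNorm_cutoff_sub {χ : ℕ → Plane → ℝ} (hχm : ∀ n, Continuous (χ n))
    (hχ1 : ∀ n x, |χ n x| ≤ 1) (hχ : ∀ x, ∀ᶠ n in atTop, χ n x = 1)
    {f : Plane → ℂ} (hf : MemLp f 2) {F : ℕ → Plane → ℂ}
    (hFm : ∀ n, AEStronglyMeasurable (F n))
    (hF : Tendsto (fun n => eLpNorm (fun x => F n x - f x) 2) atTop (𝓝 0)) :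
    Tendsto (fun n => eLpNorm (fun x => χ n x • F n x - f x) 2) atTop (𝓝 0) := by
  have h1 : Tendsto (fun n => eLpNorm (fun x => χ n x • f x - f x) 2) atTop (𝓝 0) := by
    have h2 : Tendsto (fun n => ∫⁻ x, ‖χ n x • f x - f x‖ₑ ^ 2) atTop (𝓝 (∫⁻ _ : Plane, 0)) := by
      refine tendsto_lintegral_of_dominated_convergence' (fun x => (2 * ‖f x‖ₑ) ^ 2) (fun n => ?_)
        (fun n => Eventually.of_forall fun x => ?_) ?_ (Eventually.of_forall fun x => ?_)
      · exact ((((hχm n).aestronglyMeasurable.smul hf.1).sub hf.1).enorm).pow_const 2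
      · refine pow_le_pow_left' ?_ 2
        refine enorm_sub_le.trans ?_
        rw [two_mul, enorm_smul]
        gcongr
        refine mul_le_of_le_one_left' ?_
        rw [Real.enorm_eq_ofReal_abs]
        exact ENNReal.ofReal_le_one.2 (hχ1 n x)
      · simp only [mul_pow]
        rw [lintegral_const_mul' _ _ (by simp), ← eLpNorm_two_sq]
        exact ENNReal.mul_ne_top (by simp) (ENNReal.pow_ne_top hf.2.ne)
      · refine tendsto_const_nhds.congr' ?_
        filter_upwards [hχ x] with n hn
        simp [hn]
    simp_rw [lintegral_zero, ← eLpNorm_two_sq] at h2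
    have h3 := h2.ennrpow_const (1 / 2)
    refine (h3.congr fun n => ?_).trans (by simp)
    rw [← ENNReal.rpow_natCast, ← ENNReal.rpow_mul]
    simp
  have h4 : Tendsto (fun n => eLpNorm (fun x => F n x - f x) 2
      + eLpNorm (fun x => χ n x • f x - f x) 2) atTop (𝓝 0) := by simpa using hF.add h1
  refine tendsto_of_tendsto_of_tendsto_of_le_of_le tendsto_const_nhds h4 (fun _ => zero_le)
    fun n => ?_
  have h5 : (fun x => χ n x • F n x - f x)
      = (fun x => χ n x • (F n x - f x)) + fun x => χ n x • f x - f x := by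
    ext x
    simp [mul_sub]
  rw [h5]
  refine (eLpNorm_add_le ((hχm n).aestronglyMeasurable.smul ((hFm n).sub hf.1))
    (((hχm n).aestronglyMeasurable.smul hf.1).sub hf.1) (by norm_num)).trans ?_
  refine add_le_add (eLpNorm_mono fun x => ?_) le_rfl
  rw [Pi.smul_apply', norm_smul, Real.norm_eq_abs]
  exact mul_le_of_le_one_left (norm_nonneg _) (hχ1 n x)

theorem tendsto_eLpNorm_smul_zero {a : ℕ → Plane → ℝ} {c : ℕ → ℝ} (hac : ∀ n x, |a n x| ≤ c n)
    (hc : Tendsto c atTop (𝓝 0)) {f : Plane → ℂ} (hf : MemLp f 2) {F : ℕ → Plane → ℂ}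
    (hFm : ∀ n, AEStronglyMeasurable (F n))
    (hF : Tendsto (fun n => eLpNorm (fun x => F n x - f x) 2) atTop (𝓝 0)) :
    Tendsto (fun n => eLpNorm (fun x => a n x • F n x) 2) atTop (𝓝 0) := by
  have h0 : Tendsto (fun n => ENNReal.ofReal (c n)) atTop (𝓝 0) := by
    simpa using ENNReal.tendsto_ofReal hc
  have h2 : Tendsto (fun n : ℕ => ENNReal.ofReal (c n) *
      (eLpNorm (fun x => F n x - f x) 2 + eLpNorm f 2)) atTop (𝓝 0) := by
    have hs : Tendsto (fun n => eLpNorm (fun x => F n x - f x) 2 + eLpNorm f 2) atTop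
        (𝓝 (0 + eLpNorm f 2)) := hF.add tendsto_const_nhds
    have hfin : 0 + eLpNorm f 2 ≠ ⊤ := by
      rw [zero_add]
      exact hf.2.ne
    have h3 := ENNReal.Tendsto.mul h0 (Or.inr hfin) hs (Or.inr ENNReal.zero_ne_top)
    rwa [zero_mul] at h3
  refine tendsto_of_tendsto_of_tendsto_of_le_of_le tendsto_const_nhds h2 (fun _ => zero_le)
    fun n => ?_
  refine (eLpNorm_le_mul_eLpNorm_of_ae_le_mul (g := F n) (c := c n)
    (Eventually.of_forall fun x => ?_) 2).trans ?_
  · rw [norm_smul, Real.norm_eq_abs]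
    gcongr
    exact hac n x
  · have h6 : F n = (fun x => F n x - f x) + f := by ext x; simp
    have h7 := eLpNorm_add_le (μ := volume) (p := 2) ((hFm n).sub hf.1) hf.1 (by norm_num)
    rw [show (F n - f) + f = F n by simp] at h7
    exact mul_le_mul_right h7 _

/-- Density of `C_c^∞` in `H¹`: the approximants are `χₙ (ηₙ ⋆ f)`, for which the term that contains
`∇χₙ = O(1 / n)` tends to zero. -/
theorem exists_smooth_approx {f : Plane → ℂ} {g : Fin 2 → Plane → ℂ} (hf : MemLp f 2)
    (hg : ∀ j, MemLp (g j) 2) (hfg : ∀ j, IsWeakPartial j f (g j)) :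
    ∃ w : ℕ → Plane → ℂ, (∀ n, ContDiff ℝ ∞ (w n)) ∧ (∀ n, HasCompactSupport (w n)) ∧
      Tendsto (fun n => eLpNorm (fun x => w n x - f x) 2) atTop (𝓝 0) ∧
      ∀ j, Tendsto (fun n => eLpNorm (fun x => fderiv ℝ (w n) x (axis j) - g j x) 2)
        atTop (𝓝 0) := by
  obtain ⟨χ, C, hχs, hχc, hχ1, hχ, hχd⟩ := exists_cutoff
  have hloc : LocallyIntegrable f := hf.locallyIntegrable (by norm_num)
  have hms : ∀ n, ContDiff ℝ ∞ (mollify n f) := fun n => contDiff_mollify _ hloc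
  have hfm : ∀ n, AEStronglyMeasurable (mollify n f) := fun n =>
    (hms n).continuous.aestronglyMeasurable
  have hgm : ∀ n j, AEStronglyMeasurable (mollify n (g j)) := fun n j =>
    (contDiff_mollify _ ((hg j).locallyIntegrable (by norm_num))).continuous.aestronglyMeasurable
  refine ⟨fun n x => χ n x • mollify n f x, fun n => (hχs n).smul (hms n),
    fun n => (hχc n).smul_right, ?_, fun j => ?_⟩
  · exact tendsto_eLpNorm_cutoff_sub (fun n => (hχs n).continuous) hχ1 hχ hf
      hfm (tendsto_eLpNorm_mollify_sub hf)
  · have hd : ∀ n, (fun x => fderiv ℝ (fun x => χ n x • mollify n f x) x (axis j) - g j x)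
        = (fun x => χ n x • mollify n (g j) x - g j x)
          + fun x => fderiv ℝ (χ n) x (axis j) • mollify n f x := by
      intro n
      ext x
      rw [fderiv_fun_smul ((hχs n).differentiable (by simp) x) ((hms n).differentiable (by simp) x),
        Pi.add_apply, add_apply, smul_apply, ContinuousLinearMap.smulRight_apply,
        show fderiv ℝ (mollify n f) x (axis j) = mollify n (g j) x from
          fderiv_mollify _ hloc (hfg j) x]
      abel
    have h1 := tendsto_eLpNorm_cutoff_sub (fun n => (hχs n).continuous) hχ1 hχ (hg j)
      (fun n => hgm n j) (tendsto_eLpNorm_mollify_sub (hg j))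
    have h0 : Tendsto (fun n : ℕ => C * ((n : ℝ) + 1)⁻¹) atTop (𝓝 0) := by
      rw [← mul_zero C]
      exact (tendsto_inv_atTop_zero.comp
        (tendsto_atTop_add_const_right _ 1 tendsto_natCast_atTop_atTop)).const_mul C
    have h2 := tendsto_eLpNorm_smul_zero (fun n x => hχd n x j) h0 hf hfm
      (tendsto_eLpNorm_mollify_sub hf)
    have h3 := h1.add h2
    rw [add_zero] at h3
    refine tendsto_of_tendsto_of_tendsto_of_le_of_le tendsto_const_nhds h3 (fun _ => zero_le)
      fun n => ?_
    have hm1 : AEStronglyMeasurable (fun x => χ n x • mollify n (g j) x - g j x) :=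
      ((hχs n).continuous.aestronglyMeasurable.smul (hgm n j)).sub (hg j).1
    have hm2 : Continuous fun x => fderiv ℝ (χ n) x (axis j) :=
      ((hχs n).continuous_fderiv (by simp)).clm_apply continuous_const
    have hm3 : AEStronglyMeasurable (fun x => fderiv ℝ (χ n) x (axis j) • mollify n f x) :=
      hm2.aestronglyMeasurable.smul (hfm n)
    dsimp only
    rw [hd n]
    exact eLpNorm_add_le hm1 hm3 (by norm_num)

/-! ### Ladyzhenskaya's inequality -/

theorem opNorm_le_sum_axis (D : Plane →L[ℝ] ℂ) : ‖D‖ ≤ ‖D (axis 0)‖ + ‖D (axis 1)‖ := by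
  refine D.opNorm_le_bound (by positivity) fun x => ?_
  have hx : x = x 0 • axis 0 + x 1 • axis 1 := by
    ext i
    fin_cases i <;> simp
  have h0 : ∀ i, ‖x i‖ ≤ ‖x‖ := fun i => PiLp.norm_apply_le x i
  calc ‖D x‖ = ‖x 0 • D (axis 0) + x 1 • D (axis 1)‖ := by
        conv_lhs => rw [hx]
        rw [map_add, map_smul, map_smul]
    _ ≤ ‖x 0‖ * ‖D (axis 0)‖ + ‖x 1‖ * ‖D (axis 1)‖ := by
        refine (norm_add_le _ _).trans ?_
        rw [norm_smul, norm_smul]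
    _ ≤ ‖x‖ * ‖D (axis 0)‖ + ‖x‖ * ‖D (axis 1)‖ := by
        gcongr <;> exact h0 _
    _ = _ := by ring

/-- Ladyzhenskaya's inequality `‖w‖₄² ≤ K ‖w‖₂ ‖∇w‖₂` for test functions, written with
`‖w²‖₂ = ‖w‖₄²`: the Gagliardo-Nirenberg-Sobolev inequality `‖w²‖₂ ≤ C ‖∇(w²)‖₁`, and
Hölder's inequality for `∇(w²) = 2 w ∇w`. -/
theorem eLpNorm_mul_self_le : ∃ K : NNReal, ∀ w : Plane → ℂ, ContDiff ℝ ∞ w →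
    HasCompactSupport w → eLpNorm (fun x => w x * w x) 2 volume ≤
      K * (eLpNorm w 2 * (eLpNorm (fun x => fderiv ℝ w x (axis 0)) 2
        + eLpNorm (fun x => fderiv ℝ w x (axis 1)) 2)) := by
  have hfr : NNReal.HolderConjugate (Module.finrank ℝ Plane) 2 := by
    rw [finrank_euclideanSpace_fin, NNReal.holderConjugate_iff]
    refine ⟨by norm_num, ?_⟩
    rw [← NNReal.coe_inj]
    push_cast
    norm_num
  refine ⟨eLpNormLESNormFDerivOneConst (volume : Measure Plane) 2 * 2, fun w hw hwc => ?_⟩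
  have h1 := eLpNorm_le_eLpNorm_fderiv_one volume (u := fun x => w x * w x)
    ((hw.mul hw).of_le (by simp)) hwc.mul_right hfr
  refine h1.trans ?_
  rw [ENNReal.coe_mul, mul_assoc]
  refine mul_le_mul_right ?_ _
  have hD : Continuous (fderiv ℝ w) := hw.continuous_fderiv (by simp)
  have hDj : ∀ j, Continuous fun x => fderiv ℝ w x (axis j) := fun j =>
    hD.clm_apply continuous_const
  have h2 : eLpNorm (fderiv ℝ fun x => w x * w x) 1 volume
      ≤ (2 : NNReal) * eLpNorm w 2 volume * eLpNorm (fderiv ℝ w) 2 volume := by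
    have h3 : fderiv ℝ (fun x => w x * w x)
        = fun x => w x • fderiv ℝ w x + w x • fderiv ℝ w x := by
      ext1 x
      exact fderiv_fun_mul (hw.differentiable (by simp) x) (hw.differentiable (by simp) x)
    rw [h3]
    refine eLpNorm_le_eLpNorm_mul_eLpNorm'_of_norm (p := 2) (q := 2)
      hw.continuous.aestronglyMeasurable hD.aestronglyMeasurable (fun a D => a • D + a • D) 2
      (Eventually.of_forall fun x => ?_)
    refine (norm_add_le _ _).trans ?_
    rw [norm_smul, NNReal.coe_ofNat]
    linarith
  have h4 : eLpNorm (fderiv ℝ w) 2 volume ≤ eLpNorm (fun x => fderiv ℝ w x (axis 0)) 2 volume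
        + eLpNorm (fun x => fderiv ℝ w x (axis 1)) 2 volume := by
    rw [← eLpNorm_norm (fun x => fderiv ℝ w x (axis 0)),
      ← eLpNorm_norm (fun x => fderiv ℝ w x (axis 1))]
    exact (eLpNorm_mono_real fun x => opNorm_le_sum_axis (fderiv ℝ w x)).trans
      (eLpNorm_add_le (hDj 0).norm.aestronglyMeasurable (hDj 1).norm.aestronglyMeasurable
        (by norm_num))
  refine h2.trans ?_
  rw [mul_assoc]
  exact mul_le_mul_right (mul_le_mul_right h4 _) _

theorem eventually_eLpNorm_le {f : Plane → ℂ} (hf : MemLp f 2) {F : ℕ → Plane → ℂ}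
    (hFm : ∀ n, AEStronglyMeasurable (F n))
    (hF : Tendsto (fun n => eLpNorm (fun x => F n x - f x) 2) atTop (𝓝 0)) :
    ∀ᶠ n in atTop, eLpNorm (F n) 2 ≤ 1 + eLpNorm f 2 := by
  filter_upwards [hF.eventually_lt_const one_pos] with n hn
  have h7 := eLpNorm_add_le (μ := volume) (p := 2) ((hFm n).sub hf.1) hf.1 (by norm_num)
  rw [show (F n - f) + f = F n by simp] at h7
  exact h7.trans (add_le_add hn.le le_rfl)

/-- The embedding `H¹(ℝ²) ⊆ L⁴(ℝ²)`, in the form `f² ∈ L²`. -/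
theorem memLp_mul_self_of_weakPartial {f : Plane → ℂ} {g : Fin 2 → Plane → ℂ} (hf : MemLp f 2)
    (hg : ∀ j, MemLp (g j) 2) (hfg : ∀ j, IsWeakPartial j f (g j)) :
    MemLp (fun x => f x * f x) 2 := by
  obtain ⟨w, hws, hwc, hwf, hwg⟩ := exists_smooth_approx hf hg hfg
  obtain ⟨K, hK⟩ := eLpNorm_mul_self_le
  have hwm : ∀ n, AEStronglyMeasurable (w n) := fun n => (hws n).continuous.aestronglyMeasurable
  have hdm : ∀ n j, AEStronglyMeasurable (fun x => fderiv ℝ (w n) x (axis j)) := fun n j =>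
    (((hws n).continuous_fderiv (by simp)).clm_apply continuous_const).aestronglyMeasurable
  obtain ⟨ns, hns, hae⟩ := (tendstoInMeasure_of_tendsto_eLpNorm two_ne_zero hwm hf.1
    hwf).exists_seq_tendsto_ae
  refine ⟨hf.1.mul hf.1, (Lp.eLpNorm_le_of_ae_tendsto (u := atTop)
    (f := fun n x => w (ns n) x * w (ns n) x)
    (C := K * ((1 + eLpNorm f 2) * ((1 + eLpNorm (g 0) 2) + (1 + eLpNorm (g 1) 2)))) ?_
    (fun n => (hwm _).mul (hwm _)) ?_).trans_lt ?_⟩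
  · filter_upwards [hns.tendsto_atTop.eventually (eventually_eLpNorm_le hf hwm hwf),
      hns.tendsto_atTop.eventually (eventually_eLpNorm_le (hg 0) (fun n => hdm n 0) (hwg 0)),
      hns.tendsto_atTop.eventually (eventually_eLpNorm_le (hg 1) (fun n => hdm n 1) (hwg 1))]
      with n h h0 h1
    refine (hK _ (hws _) (hwc _)).trans ?_
    gcongr
  · filter_upwards [hae] with x hx
    exact hx.mul hx
  · have := hf.2
    have := (hg 0).2
    have := (hg 1).2
    finiteness

/-! ### Integration by parts -/

theorem tendsto_integral_mul_star {a f : Plane → ℂ} (ha : MemLp a 2) (hf : MemLp f 2)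
    {F : ℕ → Plane → ℂ} (hFm : ∀ n, MemLp (F n) 2)
    (hF : Tendsto (fun n => eLpNorm (fun x => F n x - f x) 2) atTop (𝓝 0)) :
    Tendsto (fun n => ∫ x, a x * star (F n x)) atTop (𝓝 (∫ x, a x * star (f x))) := by
  have hint : ∀ {h : Plane → ℂ}, MemLp h 2 → Integrable fun x => a x * star (h x) := fun hh =>
    ha.integrable_mul hh.star
  refine tendsto_integral_of_L1' _ (hint hf).1 (Eventually.of_forall fun n => hint (hFm n)) ?_
  have h0 : Tendsto (fun n => eLpNorm a 2 * eLpNorm (fun x => F n x - f x) 2) atTop (𝓝 0) := by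
    have hne : eLpNorm a 2 volume ≠ ⊤ := ha.2.ne
    have := ENNReal.Tendsto.const_mul hF (Or.inr hne)
    rwa [mul_zero] at this
  refine tendsto_of_tendsto_of_tendsto_of_le_of_le tendsto_const_nhds h0 (fun _ => zero_le)
    fun n => ?_
  have h1 : (fun x => a x * star (F n x)) - (fun x => a x * star (f x))
      = fun x => a x * star (F n x - f x) := by
    ext x
    simp [mul_sub]
  dsimp only
  rw [h1]
  have h2 := eLpNorm_le_eLpNorm_mul_eLpNorm'_of_norm (p := 2) (q := 2) (r := 1) ha.1
    ((hFm n).1.sub hf.1) (fun y z => y * star z) 1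
    (Eventually.of_forall fun x => by rw [norm_mul, norm_star, NNReal.coe_one, one_mul])
  rw [ENNReal.coe_one, one_mul] at h2
  exact h2

theorem memLp_smul_of_hasCompactSupport {ζ : Plane → ℝ} (hζ : Continuous ζ)
    (hζc : HasCompactSupport ζ) {f : Plane → ℂ} (hf : MemLp f 2) :
    MemLp (fun x => ζ x • f x) 2 := by
  obtain ⟨C, hC⟩ := hζc.exists_bound_of_continuous hζ
  refine hf.of_le_mul (c := C) (hζ.aestronglyMeasurable.smul hf.1)
    (Eventually.of_forall fun x => ?_)
  rw [norm_smul]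
  gcongr
  exact hC x

/-- Complex valued test functions are admissible in the definition of the weak derivative. -/
theorem IsWeakPartial.integral_complex {j : Fin 2} {u g : Plane → ℂ} (hu : MemLp u 2)
    (hg : MemLp g 2) (h : IsWeakPartial j u g) {θ : Plane → ℂ} (hθ : ContDiff ℝ ∞ θ)
    (hθc : HasCompactSupport θ) :
    ∫ x, fderiv ℝ θ x (axis j) * u x = -∫ x, θ x * g x := by
  have key : ∀ L : ℂ →L[ℝ] ℝ, ∫ x, L (fderiv ℝ θ x (axis j)) • u x = -∫ x, L (θ x) • g x := by
    intro L
    rw [← h (fun x => L (θ x)) (L.contDiff.comp hθ) (hθc.comp_left (map_zero L))]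
    refine integral_congr_ae (Eventually.of_forall fun x => ?_)
    have := (L.hasFDerivAt.comp x (hθ.differentiable (by simp) x).hasFDerivAt).fderiv
    simp only
    rw [show (fun x => L (θ x)) = L ∘ θ from rfl, this]
    rfl
  have hd : Continuous fun x => fderiv ℝ θ x (axis j) :=
    (hθ.continuous_fderiv (by simp)).clm_apply continuous_const
  have hdc : HasCompactSupport fun x => fderiv ℝ θ x (axis j) := hθc.fderiv_apply ℝ (axis j)
  have hint : ∀ {a b : Plane → ℂ} (L : ℂ →L[ℝ] ℝ), Continuous a → HasCompactSupport a →
      MemLp b 2 → Integrable fun x => L (a x) • b x := by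
    intro a b L ha hac hb
    have := (hb.locallyIntegrable (by norm_num)).integrable_smul_left_of_hasCompactSupport
      (L.continuous.comp ha) (hac.comp_left (map_zero L))
    exact this
  have split : ∀ {a b : Plane → ℂ}, Continuous a → HasCompactSupport a → MemLp b 2 →
      ∫ x, a x * b x = (∫ x, Complex.reCLM (a x) • b x)
        + Complex.I * ∫ x, Complex.imCLM (a x) • b x := by
    intro a b ha hac hb
    rw [← integral_const_mul, ← integral_add (hint _ ha hac hb) ((hint _ ha hac hb).const_mul _)]
    refine integral_congr_ae (Eventually.of_forall fun x => ?_)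
    simp only [Complex.reCLM_apply, Complex.imCLM_apply, Complex.real_smul]
    conv_lhs => rw [← Complex.re_add_im (a x)]
    ring
  rw [split hd hdc hu, split hθ.continuous hθc hg, key, key]
  ring

/-- The product rule for `u φ̄` with `u, φ ∈ H¹`. The products are only integrable, and the test
function `ζ φ̄` is reached through smooth approximations of `φ`. -/
theorem IsWeakPartial.mul_star {j : Fin 2} {u g : Plane → ℂ} (hu : MemLp u 2)
    (hg : MemLp g 2) (h : IsWeakPartial j u g) {φ : Plane → ℂ} {k : Fin 2 → Plane → ℂ}
    (hφ : MemLp φ 2) (hk : ∀ i, MemLp (k i) 2) (hφk : ∀ i, IsWeakPartial i φ (k i)) :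
    IsWeakPartial j (fun x => u x * star (φ x)) fun x => g x * star (φ x) + u x * star (k j x) := by
  intro ζ hζ hζc
  obtain ⟨w, hws, hwc, hwf, hwg⟩ := exists_smooth_approx hφ hk hφk
  have hdζ : Continuous fun x => fderiv ℝ ζ x (axis j) :=
    (hζ.continuous_fderiv (by simp)).clm_apply continuous_const
  have hdζc : HasCompactSupport fun x => fderiv ℝ ζ x (axis j) := hζc.fderiv_apply ℝ (axis j)
  have hdw : ∀ n, Continuous fun x => fderiv ℝ (w n) x (axis j) := fun n =>
    ((hws n).continuous_fderiv (by simp)).clm_apply continuous_const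
  have m1 := memLp_smul_of_hasCompactSupport hζ.continuous hζc hu
  have m2 := memLp_smul_of_hasCompactSupport hζ.continuous hζc hg
  have m3 := memLp_smul_of_hasCompactSupport hdζ hdζc hu
  have mw : ∀ n, MemLp (w n) 2 := fun n => (hws n).continuous.memLp_of_hasCompactSupport (hwc n)
  have mdw : ∀ n, MemLp (fun x => fderiv ℝ (w n) x (axis j)) 2 := fun n =>
    (hdw n).memLp_of_hasCompactSupport ((hwc n).fderiv_apply ℝ (axis j))
  have hws' : ∀ n, ContDiff ℝ ∞ fun x => star (w n x) := fun n =>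
    (starL' ℝ : ℂ ≃L[ℝ] ℂ).contDiff.comp (hws n)
  have int : ∀ {a b : Plane → ℂ}, MemLp a 2 → MemLp b 2 → Integrable fun x => a x * star (b x) :=
    fun ha hb => ha.integrable_mul hb.star
  have eq : ∀ n, (∫ x, (ζ x • u x) * star (fderiv ℝ (w n) x (axis j)))
      + (∫ x, (fderiv ℝ ζ x (axis j) • u x) * star (w n x))
        = -∫ x, (ζ x • g x) * star (w n x) := by
    intro n
    have hθ : ContDiff ℝ ∞ fun x => ζ x • star (w n x) := hζ.smul (hws' n)
    have h1 := h.integral_complex hu hg hθ hζc.smul_right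
    rw [← integral_add (int m1 (mdw n)) (int m3 (mw n))]
    refine Eq.trans (integral_congr_ae (Eventually.of_forall fun x => ?_))
      (h1.trans (congrArg Neg.neg (integral_congr_ae (Eventually.of_forall fun x => ?_))))
    · simp only
      rw [fderiv_fun_smul (hζ.differentiable (by simp) x)
        ((hws' n).differentiable (by simp) x), fderiv_star]
      simp
      ring
    · simp
      ring
  have lim := tendsto_nhds_unique
    (((tendsto_integral_mul_star m1 (hk j) mdw (hwg j)).add
      (tendsto_integral_mul_star m3 hφ mw hwf)).congr eq)
    (tendsto_integral_mul_star m2 hφ mw hwf).neg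
  have e1 : ∫ x, ζ x • (g x * star (φ x) + u x * star (k j x))
      = (∫ x, (ζ x • g x) * star (φ x)) + ∫ x, (ζ x • u x) * star (k j x) := by
    rw [← integral_add (int m2 hφ) (int m1 (hk j))]
    simp only [smul_add, smul_mul_assoc]
  have e2 : ∫ x, fderiv ℝ ζ x (axis j) • (u x * star (φ x))
      = ∫ x, (fderiv ℝ ζ x (axis j) • u x) * star (φ x) := by
    simp only [smul_mul_assoc]
  rw [e1, e2]
  linear_combination lim

/-- The integral of `x_i ∂_j F = ∂_j (x_i F)` vanishes for `i ≠ j`, if `x_i F` and `x_i ∂_j F` are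
integrable. -/
theorem IsWeakPartial.integral_coord_mul_eq_zero {i j : Fin 2} (hij : i ≠ j) {F G : Plane → ℂ}
    (h : IsWeakPartial j F G) (hF : Integrable fun x => x i • F x)
    (hG : Integrable fun x => x i • G x) : ∫ x, x i • G x = 0 := by
  obtain ⟨χ, C, hχs, hχc, hχ1, hχ, hχd⟩ := exists_cutoff
  have hC : 0 ≤ C := by
    have := (abs_nonneg _).trans (hχd 0 0 0)
    simpa using this
  have hcoord : ContDiff ℝ ∞ fun x : Plane => x i := by fun_prop
  have hd : ∀ n x, fderiv ℝ (fun x : Plane => χ n x * x i) x (axis j)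
      = fderiv ℝ (χ n) x (axis j) * x i := by
    intro n x
    have h1 : fderiv ℝ (fun x : Plane => x i) x = EuclideanSpace.proj i :=
      (EuclideanSpace.proj (𝕜 := ℝ) i).fderiv
    rw [fderiv_fun_mul ((hχs n).differentiable (by simp) x) (hcoord.differentiable (by simp) x), h1]
    simp [hij, mul_comm]
  have eq : ∀ n, ∫ x, fderiv ℝ (χ n) x (axis j) • (x i • F x)
      = -∫ x, χ n x • (x i • G x) := by
    intro n
    have := h (fun x => χ n x * x i) ((hχs n).mul hcoord) (hχc n).mul_right
    simp only [hd] at this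
    simpa only [mul_smul] using this
  have h0 : Tendsto (fun n : ℕ => C * ((n : ℝ) + 1)⁻¹) atTop (𝓝 0) := by
    rw [← mul_zero C]
    exact (tendsto_inv_atTop_zero.comp
      (tendsto_atTop_add_const_right _ 1 tendsto_natCast_atTop_atTop)).const_mul C
  have lim1 : Tendsto (fun n => ∫ x, fderiv ℝ (χ n) x (axis j) • (x i • F x)) atTop
      (𝓝 (∫ _ : Plane, 0)) := by
    refine tendsto_integral_of_dominated_convergence (fun x => C * ‖x i • F x‖) (fun n => ?_)
      (hF.norm.const_mul C) (fun n => Eventually.of_forall fun x => ?_)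
      (Eventually.of_forall fun x => ?_)
    · exact (((hχs n).continuous_fderiv (by simp)).clm_apply
        continuous_const).aestronglyMeasurable.smul hF.1
    · rw [norm_smul, Real.norm_eq_abs]
      gcongr
      refine (hχd n x j).trans (mul_le_of_le_one_right hC (inv_le_one_of_one_le₀ ?_))
      have : (0 : ℝ) ≤ n := n.cast_nonneg
      linarith
    · have h1 : Tendsto (fun n => fderiv ℝ (χ n) x (axis j)) atTop (𝓝 0) :=
        squeeze_zero_norm (fun n => hχd n x j) h0
      simpa using h1.smul_const (x i • F x)
  have lim2 : Tendsto (fun n => ∫ x, χ n x • (x i • G x)) atTop (𝓝 (∫ x, x i • G x)) := by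
    refine tendsto_integral_of_dominated_convergence (fun x => ‖x i • G x‖) (fun n => ?_)
      hG.norm (fun n => Eventually.of_forall fun x => ?_) (Eventually.of_forall fun x => ?_)
    · exact (hχs n).continuous.aestronglyMeasurable.smul hG.1
    · rw [norm_smul, Real.norm_eq_abs]
      exact mul_le_of_le_one_left (norm_nonneg _) (hχ1 n x)
    · refine tendsto_const_nhds.congr' ?_
      filter_upwards [hχ x] with n hn
      rw [hn, one_smul]
  have := tendsto_nhds_unique (lim1.congr eq) lim2.neg
  simpa using this.symm

/-! ### Linearity of weak derivatives and integrability in the energy space -/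

theorem MemH1.memLp_weakPartial {u : Plane → ℂ} (hu : MemH1 u) (j : Fin 2) :
    MemLp (weakPartial j u) 2 := by
  rw [weakPartial, dif_pos (hu.2 j)]
  exact (hu.2 j).choose_spec.1

theorem MemH1.isWeakPartial {u : Plane → ℂ} (hu : MemH1 u) (j : Fin 2) :
    IsWeakPartial j u (weakPartial j u) := by
  rw [weakPartial, dif_pos (hu.2 j)]
  exact (hu.2 j).choose_spec.2

theorem MemH1.weakPartial_ae_eq {u g : Plane → ℂ} (hu : MemH1 u) {j : Fin 2} (hg : MemLp g 2)
    (h : IsWeakPartial j u g) : weakPartial j u =ᵐ[volume] g := by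
  refine ae_eq_of_integral_contDiff_smul_eq
    ((hu.memLp_weakPartial j).locallyIntegrable (by norm_num))
    (hg.locallyIntegrable (by norm_num)) fun ζ hζ hζc => ?_
  rw [← neg_inj, ← h ζ hζ hζc, hu.isWeakPartial j ζ hζ hζc]

theorem IsWeakPartial.add_smul {j : Fin 2} {u φ g h : Plane → ℂ} (hu : MemLp u 2)
    (hφ : MemLp φ 2) (hg : MemLp g 2) (hh : MemLp h 2) (hug : IsWeakPartial j u g)
    (hφh : IsWeakPartial j φ h) (t : ℝ) : IsWeakPartial j (u + t • φ) (g + t • h) := by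
  intro ζ hζ hζc
  have int : ∀ {a : Plane → ℝ} {b : Plane → ℂ}, Continuous a → HasCompactSupport a →
      MemLp b 2 → Integrable fun x => a x • b x := fun ha hac hb =>
    (hb.locallyIntegrable (by norm_num)).integrable_smul_left_of_hasCompactSupport ha hac
  have hd : Continuous fun x => fderiv ℝ ζ x (axis j) :=
    (hζ.continuous_fderiv (by simp)).clm_apply continuous_const
  have hdc : HasCompactSupport fun x => fderiv ℝ ζ x (axis j) := hζc.fderiv_apply ℝ (axis j)
  have split : ∀ {a : Plane → ℝ} {b c : Plane → ℂ}, Continuous a → HasCompactSupport a →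
      MemLp b 2 → MemLp c 2 →
      ∫ x, a x • (b + t • c) x = (∫ x, a x • b x) + t • ∫ x, a x • c x := by
    intro a b c ha hac hb hc
    rw [← integral_smul, ← integral_add (int ha hac hb)
      (show Integrable fun x => t • (a x • c x) from (int ha hac hc).smul t)]
    refine integral_congr_ae (Eventually.of_forall fun x => ?_)
    simp only [Pi.add_apply, Pi.smul_apply, smul_add]
    rw [smul_comm (a x) t (c x)]
  have h1 := hug ζ hζ hζc
  have h2 := hφh ζ hζ hζc
  rw [split hd hdc hu hφ, split hζ.continuous hζc hg hh, h1, h2]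
  rw [smul_neg, neg_add]

theorem MemH1.add_smul {u φ : Plane → ℂ} (hu : MemH1 u) (hφ : MemH1 φ) (t : ℝ) :
    MemH1 (u + t • φ) :=
  ⟨hu.1.add (hφ.1.const_smul t), fun j => ⟨weakPartial j u + t • weakPartial j φ,
    (hu.memLp_weakPartial j).add ((hφ.memLp_weakPartial j).const_smul t),
    (hu.isWeakPartial j).add_smul hu.1 hφ.1 (hu.memLp_weakPartial j) (hφ.memLp_weakPartial j)
      (hφ.isWeakPartial j) t⟩⟩

theorem weakPartial_add_smul {u φ : Plane → ℂ} (hu : MemH1 u) (hφ : MemH1 φ) (t : ℝ)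
    (j : Fin 2) :
    weakPartial j (u + t • φ) =ᵐ[volume] weakPartial j u + t • weakPartial j φ :=
  (hu.add_smul hφ t).weakPartial_ae_eq
    ((hu.memLp_weakPartial j).add ((hφ.memLp_weakPartial j).const_smul t))
    ((hu.isWeakPartial j).add_smul hu.1 hφ.1 (hu.memLp_weakPartial j) (hφ.memLp_weakPartial j)
      (hφ.isWeakPartial j) t)

theorem MemH1.memLp_mul_self {u : Plane → ℂ} (hu : MemH1 u) : MemLp (fun x => u x * u x) 2 :=
  memLp_mul_self_of_weakPartial hu.1 hu.memLp_weakPartial hu.isWeakPartial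

theorem integrable_normSq {f : Plane → ℂ} (hf : MemLp f 2) : Integrable fun x => ‖f x‖ ^ 2 :=
  hf.norm.integrable_sq

theorem integrable_mul_star {f g : Plane → ℂ} (hf : MemLp f 2) (hg : MemLp g 2) :
    Integrable fun x => f x * star (g x) :=
  hf.integrable_mul hg.star

/-- The embedding `H¹(ℝ²) ⊆ L^q(ℝ²)` for `2 ≤ q ≤ 4`, since `|u|^q ≤ |u|² + |u|⁴`. -/
theorem MemH1.memLp_rpow {u : Plane → ℂ} (hu : MemH1 u) {q : ℝ} (hq2 : 2 ≤ q) (hq4 : q ≤ 4) :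
    MemLp u (ENNReal.ofReal q) := by
  have hq0 : 0 < q := by linarith
  have h4 : Integrable fun x => ‖u x * u x‖ ^ 2 := integrable_normSq hu.memLp_mul_self
  have h := (integrable_normSq hu.1).add h4
  rw [← integrable_norm_rpow_iff hu.1.1 (by simpa using hq0) ENNReal.ofReal_ne_top,
    ENNReal.toReal_ofReal hq0.le]
  refine h.mono' (hu.1.1.norm.aemeasurable.pow_const q).aestronglyMeasurable
    (Eventually.of_forall fun x => ?_)
  rw [Real.norm_of_nonneg (by positivity)]
  simp only [Pi.add_apply, norm_mul]
  rcases le_total ‖u x‖ 1 with h1 | h1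
  · have := Real.rpow_le_rpow_of_exponent_ge_of_imp (norm_nonneg (u x)) h1 hq2 (by intro _ _; linarith)
    rw [Real.rpow_two] at this
    nlinarith [sq_nonneg (‖u x‖ * ‖u x‖)]
  · have := Real.rpow_le_rpow_of_exponent_le h1 hq4
    rw [show (4 : ℝ) = ((4 : ℕ) : ℝ) by norm_num, Real.rpow_natCast] at this
    nlinarith [sq_nonneg ‖u x‖]


variable {V : Plane → ℝ}

theorem IsTrapping.aestronglyMeasurable (hV : IsTrapping V) :
    AEStronglyMeasurable V (volume : Measure Plane) := by
  have h : ∀ n : ℕ, AEStronglyMeasurable V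
      ((volume : Measure Plane).restrict (Metric.closedBall 0 (n : ℝ))) := fun n =>
    (hV.locallyBounded _ (isCompact_closedBall 0 _)).1
  have := aestronglyMeasurable_iUnion_iff.2 h
  rwa [Metric.iUnion_closedBall_nat, Measure.restrict_univ] at this

/-- The growth of `V` at infinity and its positivity, combined into one global inequality. -/
theorem IsTrapping.exists_quadratic_bound (hV : IsTrapping V) :
    ∃ A B : ℝ, 0 ≤ A ∧ 0 ≤ B ∧ ∀ᵐ x : Plane, ‖x‖ ^ 2 ≤ A + B * V x := by
  obtain ⟨c, hc0, hc⟩ := EReal.lt_iff_exists_real_btwn.1 hV.growth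
  have hc0 : 0 < c := by exact_mod_cast hc0
  have h := eventually_lt_of_lt_liminf hc
  obtain ⟨s, hs, t, ht, hst⟩ := (mem_inf_iff).1 h
  obtain ⟨K, hK, hKs⟩ := mem_cocompact.1 hs
  obtain ⟨R, hR⟩ := hK.isBounded.exists_norm_le
  -- Inside `K` the norm is at most `R`; outside, `V x ≥ c ‖x‖²` almost everywhere.
  refine ⟨R ^ 2, c⁻¹, by positivity, by positivity, ?_⟩
  filter_upwards [ht, hV.nonneg] with x hx hVx
  by_cases hxK : x ∈ K
  · have h1 := hR x hxK
    have : ‖x‖ ^ 2 ≤ R ^ 2 := by gcongr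
    have : 0 ≤ c⁻¹ * V x := by positivity
    linarith
  · have hx2 : x ∈ s ∩ t := ⟨hKs hxK, hx⟩
    rw [← hst] at hx2
    have h3 : c < V x / ‖x‖ ^ 2 := by exact_mod_cast hx2
    have h4 : ‖x‖ ^ 2 ≤ c⁻¹ * V x := by
      rcases eq_or_lt_of_le (sq_nonneg ‖x‖) with h0 | h0
      · rw [← h0]
        positivity
      · rw [lt_div_iff₀ h0] at h3
        rw [inv_mul_eq_div, le_div_iff₀ hc0]
        linarith
    have : 0 ≤ R ^ 2 := by positivity
    linarith

/-- On the energy space the first moments `x_i u` are square integrable. -/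
theorem memLp_coord_smul (hV : IsTrapping V) {u : Plane → ℂ} (hu : u ∈ energySpace V)
    (i : Fin 2) : MemLp (fun x => x i • u x) 2 := by
  obtain ⟨A, B, hA, hB, hAB⟩ := hV.exists_quadratic_bound
  have hm : AEStronglyMeasurable (fun x : Plane => x i • u x) :=
    (show Continuous fun x : Plane => x i by fun_prop).aestronglyMeasurable.smul hu.1.1.1
  rw [← memLp_norm_iff hm, memLp_two_iff_integrable_sq hm.norm]
  refine (((integrable_normSq hu.1.1).const_mul A).add (hu.2.const_mul B)).mono'
    (hm.norm.pow 2) ?_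
  filter_upwards [hAB] with x hx
  have h1 : ‖x i‖ ^ 2 ≤ ‖x‖ ^ 2 := by
    gcongr
    exact PiLp.norm_apply_le x i
  rw [Real.norm_of_nonneg (by positivity), norm_smul, mul_pow]
  simp only [Pi.add_apply]
  have := mul_le_mul_of_nonneg_right (h1.trans hx) (sq_nonneg ‖u x‖)
  linarith

theorem normSq_add_smul (z w : ℂ) (t : ℝ) :
    ‖z + t • w‖ ^ 2 = ‖z‖ ^ 2 + 2 * t * (z * star w).re + t ^ 2 * ‖w‖ ^ 2 := by
  simp only [← Complex.normSq_eq_norm_sq, Complex.normSq_apply]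
  simp
  ring

theorem integrable_potential_mul_star (hV : IsTrapping V) {u φ : Plane → ℂ}
    (hu : u ∈ energySpace V) (hφ : φ ∈ energySpace V) :
    Integrable fun x => (V x : ℂ) * (u x * star (φ x)) := by
  refine (hu.2.add hφ.2).mono' ((Complex.continuous_ofReal.comp_aestronglyMeasurable
    hV.aestronglyMeasurable).mul (hu.1.1.1.mul hφ.1.1.1.star)) ?_
  filter_upwards [hV.nonneg] with x hx
  simp only [norm_mul, norm_star, Complex.norm_real, Real.norm_of_nonneg hx, Pi.add_apply]
  nlinarith [mul_nonneg hx (sq_nonneg (‖u x‖ - ‖φ x‖)), mul_nonneg hx (sq_nonneg (‖u x‖)),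
    mul_nonneg hx (sq_nonneg (‖φ x‖))]

theorem add_smul_mem_energySpace (hV : IsTrapping V) {u φ : Plane → ℂ}
    (hu : u ∈ energySpace V) (hφ : φ ∈ energySpace V) (t : ℝ) :
    u + t • φ ∈ energySpace V := by
  refine ⟨hu.1.add_smul hφ.1 t, ?_⟩
  refine ((hu.2.add ((integrable_potential_mul_star hV hu hφ).re.const_mul (2 * t))).add
    (hφ.2.const_mul (t ^ 2))).congr (Eventually.of_forall fun x => ?_)
  have h1 := normSq_add_smul (u x) (φ x) t
  simp only [Pi.add_apply, Pi.smul_apply, RCLike.re_to_complex, Complex.re_ofReal_mul]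
  rw [h1]
  ring

/-! ### The quadratic part of the energy -/

theorem integrable_gradPairing {u φ : Plane → ℂ} (hu : MemH1 u) (hφ : MemH1 φ) :
    Integrable (gradPairing u φ) :=
  integrable_finsetSum _ fun j _ =>
    integrable_mul_star (hu.memLp_weakPartial j) (hφ.memLp_weakPartial j)

theorem integrable_gradSq {u : Plane → ℂ} (hu : MemH1 u) : Integrable (gradSq u) :=
  integrable_finsetSum _ fun j _ => integrable_normSq (hu.memLp_weakPartial j)

theorem memLp_perp_mul (hV : IsTrapping V) {u : Plane → ℂ} (hu : u ∈ energySpace V)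
    (j : Fin 2) : MemLp (fun x => (perp x j : ℂ) * u x) 2 := by
  fin_cases j
  · refine (memLp_coord_smul hV hu 1).neg.ae_eq (Eventually.of_forall fun x => ?_)
    simp [perp]
  · refine (memLp_coord_smul hV hu 0).ae_eq (Eventually.of_forall fun x => ?_)
    simp [perp]

theorem integrable_rotDeriv_mul_star (hV : IsTrapping V) {u φ : Plane → ℂ} (hu : MemH1 u)
    (hφ : φ ∈ energySpace V) : Integrable fun x => rotDeriv u x * star (φ x) := by
  have h : Integrable fun x => ∑ j, weakPartial j u x * star ((perp x j : ℂ) * φ x) :=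
    integrable_finsetSum _ fun j _ =>
      integrable_mul_star (hu.memLp_weakPartial j) (memLp_perp_mul hV hφ j)
  refine h.congr (Eventually.of_forall fun x => ?_)
  simp only [rotDeriv, Finset.sum_mul, star_mul', Complex.star_def, Complex.conj_ofReal]
  exact Finset.sum_congr rfl fun j _ => by ring

/-- In terms of `x^⊥ · ∇u`, the density of the angular momentum is `Im ((x^⊥ · ∇u) ū)`. -/
theorem rotDensity_eq (u : Plane → ℂ) (x : Plane) :
    rotDensity u x = (rotDeriv u x * star (u x)).im := by
  simp only [rotDensity, rotDeriv, current, Finset.sum_mul, Complex.im_sum]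
  refine Finset.sum_congr rfl fun j _ => ?_
  simp
  ring

theorem integrable_rotDensity (hV : IsTrapping V) {u : Plane → ℂ} (hu : u ∈ energySpace V) :
    Integrable (rotDensity u) := by
  refine (integrable_rotDeriv_mul_star hV hu.1 hu).im.congr (Eventually.of_forall fun x => ?_)
  simp [rotDensity_eq]

/-- The rotation form `Im ∫ (x^⊥ · ∇u) φ̄` is symmetric, because the field `x^⊥` is divergence
free and so `x^⊥ · ∇(u φ̄)` has vanishing integral. -/
theorem integral_rotDeriv_symm (hV : IsTrapping V) {u φ : Plane → ℂ} (hu : u ∈ energySpace V)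
    (hφ : φ ∈ energySpace V) :
    ∫ x, (rotDeriv u x * star (φ x)).im = ∫ x, (rotDeriv φ x * star (u x)).im := by
  have key : ∀ i j : Fin 2, i ≠ j → Integrable (fun x : Plane =>
      x i • (weakPartial j u x * star (φ x) + u x * star (weakPartial j φ x))) ∧
      ∫ x : Plane, x i • (weakPartial j u x * star (φ x) + u x * star (weakPartial j φ x)) = 0 := by
    intro i j hij
    have h1 := (hu.1.isWeakPartial j).mul_star hu.1.1 (hu.1.memLp_weakPartial j) hφ.1.1
      hφ.1.memLp_weakPartial hφ.1.isWeakPartial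
    have hF : Integrable fun x : Plane => x i • (u x * star (φ x)) := by
      simpa only [smul_mul_assoc] using integrable_mul_star (memLp_coord_smul hV hu i) hφ.1.1
    have hG : Integrable fun x : Plane =>
        x i • (weakPartial j u x * star (φ x) + u x * star (weakPartial j φ x)) := by
      refine ((integrable_mul_star (hu.1.memLp_weakPartial j) (memLp_coord_smul hV hφ i)).add
        (integrable_mul_star (memLp_coord_smul hV hu i) (hφ.1.memLp_weakPartial j))).congr
        (Eventually.of_forall fun x => ?_)
      simp
      ring
    exact ⟨hG, h1.integral_coord_mul_eq_zero hij hF hG⟩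
  -- `x^⊥ · ∇ = x₁ ∂₂ - x₂ ∂₁`, with the coordinates numbered from one.
  obtain ⟨i0, e0⟩ := key 1 0 (by decide)
  obtain ⟨i1, e1⟩ := key 0 1 (by decide)
  have h2 := integral_sub i1 i0
  rw [e0, e1, sub_zero] at h2
  have h3 : ∫ x : Plane, (x 0 • (weakPartial 1 u x * star (φ x) + u x * star (weakPartial 1 φ x))
      - x 1 • (weakPartial 0 u x * star (φ x) + u x * star (weakPartial 0 φ x))).im = 0 := by
    have := integral_im (i1.sub i0)
    simp only [Pi.sub_apply, RCLike.im_to_complex] at this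
    rw [this, h2]
    simp
  have j1 := (integrable_rotDeriv_mul_star hV hu.1 hφ).im
  have j2 := (integrable_rotDeriv_mul_star hV hφ.1 hu).im
  rw [← sub_eq_zero]
  refine (integral_sub j1 j2).symm.trans (Eq.trans ?_ h3)
  refine integral_congr_ae (Eventually.of_forall fun x => ?_)
  simp [rotDeriv, perp]
  ring

/-- The quadratic part `∫ (|∇u|² + V |u|²) - Ω ∫ x^⊥ · (iu, ∇u)` of the energy. -/
noncomputable def quadForm (V : Plane → ℝ) (Ω : ℝ) (u : Plane → ℂ) : ℝ :=
  (∫ x, (gradSq u x + V x * ‖u x‖ ^ 2)) - Ω * ∫ x, rotDensity u x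

/-- The real bilinear form associated with `quadForm`. -/
noncomputable def bilinForm (V : Plane → ℝ) (Ω : ℝ) (u φ : Plane → ℂ) : ℝ :=
  (∫ x, (gradPairing u φ x).re) + (∫ x, V x * (u x * star (φ x)).re)
    - Ω * ∫ x, (rotDeriv u x * star (φ x)).im

/-- The real part of the `L²` inner product. -/
noncomputable def massForm (u φ : Plane → ℂ) : ℝ := ∫ x, (u x * star (φ x)).re

/-- The squared `L²` norm. -/
noncomputable def mass (u : Plane → ℂ) : ℝ := ∫ x, ‖u x‖ ^ 2

theorem mul_star_self_re (z : ℂ) : (z * star z).re = ‖z‖ ^ 2 := by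
  rw [← Complex.normSq_eq_norm_sq, Complex.normSq_apply]
  simp

theorem integrable_potential_re (hV : IsTrapping V) {u φ : Plane → ℂ}
    (hu : u ∈ energySpace V) (hφ : φ ∈ energySpace V) :
    Integrable fun x => V x * (u x * star (φ x)).re := by
  simpa only [RCLike.re_to_complex, Complex.re_ofReal_mul] using
    (integrable_potential_mul_star hV hu hφ).re

theorem mass_add_smul {u φ : Plane → ℂ} (hu : MemLp u 2) (hφ : MemLp φ 2) (t : ℝ) :
    mass (u + t • φ) = mass u + 2 * t * massForm u φ + t ^ 2 * mass φ := by
  have i1 : Integrable fun x => 2 * t * (u x * star (φ x)).re :=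
    (integrable_mul_star hu hφ).re.const_mul _
  have i2 : Integrable fun x => t ^ 2 * ‖φ x‖ ^ 2 := (integrable_normSq hφ).const_mul _
  have i3 : Integrable fun x => ‖u x‖ ^ 2 + 2 * t * (u x * star (φ x)).re :=
    (integrable_normSq hu).add i1
  simp only [mass, massForm, Pi.add_apply, Pi.smul_apply, normSq_add_smul]
  rw [integral_add i3 i2, integral_add (integrable_normSq hu) i1, integral_const_mul,
    integral_const_mul]

theorem mass_smul (t : ℝ) (u : Plane → ℂ) : mass (t • u) = t ^ 2 * mass u := by
  simp only [mass, Pi.smul_apply, norm_smul, mul_pow, Real.norm_eq_abs, sq_abs, integral_const_mul]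

theorem gradSq_add_smul {u φ : Plane → ℂ} (hu : MemH1 u) (hφ : MemH1 φ) (t : ℝ) :
    gradSq (u + t • φ) =ᵐ[volume] fun x =>
      gradSq u x + 2 * t * (gradPairing u φ x).re + t ^ 2 * gradSq φ x := by
  filter_upwards [weakPartial_add_smul hu hφ t 0, weakPartial_add_smul hu hφ t 1] with x h0 h1
  simp only [gradSq, gradPairing, Fin.sum_univ_two, h0, h1, Pi.add_apply, Pi.smul_apply,
    normSq_add_smul, Complex.add_re]
  ring

theorem rotDensity_add_smul {u φ : Plane → ℂ} (hu : MemH1 u) (hφ : MemH1 φ) (t : ℝ) :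
    rotDensity (u + t • φ) =ᵐ[volume] fun x =>
      rotDensity u x + t * ((rotDeriv u x * star (φ x)).im + (rotDeriv φ x * star (u x)).im)
        + t ^ 2 * rotDensity φ x := by
  filter_upwards [weakPartial_add_smul hu hφ t 0, weakPartial_add_smul hu hφ t 1] with x h0 h1
  simp only [rotDensity_eq, rotDeriv, Fin.sum_univ_two, h0, h1, Pi.add_apply, Pi.smul_apply]
  simp
  ring

theorem quadForm_eq {Ω : ℝ} {u : Plane → ℂ} (hu : u ∈ energySpace V) : quadForm V Ω u =
    (∫ x, gradSq u x) + (∫ x, V x * ‖u x‖ ^ 2) - Ω * ∫ x, rotDensity u x := by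
  rw [quadForm, integral_add (integrable_gradSq hu.1) hu.2]

theorem integral_quadratic {a b c : Plane → ℝ} (ha : Integrable a) (hb : Integrable b)
    (hc : Integrable c) (r s : ℝ) :
    ∫ x, (a x + r * b x + s * c x) = (∫ x, a x) + r * (∫ x, b x) + s * ∫ x, c x := by
  have i1 := hb.const_mul r
  have i2 := hc.const_mul s
  have i3 : Integrable fun x => a x + r * b x := ha.add i1
  rw [integral_add i3 i2, integral_add ha i1, integral_const_mul, integral_const_mul]

theorem quadForm_add_smul (hV : IsTrapping V) (Ω : ℝ) {u φ : Plane → ℂ}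
    (hu : u ∈ energySpace V) (hφ : φ ∈ energySpace V) (t : ℝ) :
    quadForm V Ω (u + t • φ)
      = quadForm V Ω u + 2 * t * bilinForm V Ω u φ + t ^ 2 * quadForm V Ω φ := by
  have j1 : Integrable fun x => (rotDeriv u x * star (φ x)).im :=
    (integrable_rotDeriv_mul_star hV hu.1 hφ).im
  have j2 : Integrable fun x => (rotDeriv φ x * star (u x)).im :=
    (integrable_rotDeriv_mul_star hV hφ.1 hu).im
  have e1 : ∫ x, gradSq (u + t • φ) x = (∫ x, gradSq u x)
      + 2 * t * (∫ x, (gradPairing u φ x).re) + t ^ 2 * ∫ x, gradSq φ x := by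
    rw [integral_congr_ae (gradSq_add_smul hu.1 hφ.1 t)]
    exact integral_quadratic (integrable_gradSq hu.1) (integrable_gradPairing hu.1 hφ.1).re
      (integrable_gradSq hφ.1) _ _
  have e2 : ∫ x, V x * ‖(u + t • φ) x‖ ^ 2 = (∫ x, V x * ‖u x‖ ^ 2)
      + 2 * t * (∫ x, V x * (u x * star (φ x)).re) + t ^ 2 * ∫ x, V x * ‖φ x‖ ^ 2 := by
    rw [← integral_quadratic hu.2 (integrable_potential_re hV hu hφ) hφ.2]
    refine integral_congr_ae (Eventually.of_forall fun x => ?_)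
    simp only [Pi.add_apply, Pi.smul_apply, normSq_add_smul]
    ring
  have e3 : ∫ x, rotDensity (u + t • φ) x = (∫ x, rotDensity u x)
      + t * (2 * ∫ x, (rotDeriv u x * star (φ x)).im) + t ^ 2 * ∫ x, rotDensity φ x := by
    rw [integral_congr_ae (rotDensity_add_smul hu.1 hφ.1 t)]
    refine (integral_quadratic (integrable_rotDensity hV hu) (j1.add j2)
      (integrable_rotDensity hV hφ) _ _).trans ?_
    congr 3
    refine (integral_add j1 j2).trans ?_
    rw [← integral_rotDeriv_symm hV hu hφ, two_mul]
  rw [quadForm_eq (add_smul_mem_energySpace hV hu hφ t), quadForm_eq hu, quadForm_eq hφ,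
    e1, e2, e3, bilinForm]
  ring

theorem bilinForm_self {Ω : ℝ} {u : Plane → ℂ} (hu : u ∈ energySpace V) :
    bilinForm V Ω u u = quadForm V Ω u := by
  rw [quadForm_eq hu]
  simp only [bilinForm, gradPairing, Complex.re_sum, mul_star_self_re, ← rotDensity_eq, gradSq]

theorem quadForm_smul (hV : IsTrapping V) (Ω : ℝ) {u : Plane → ℂ} (hu : u ∈ energySpace V)
    (t : ℝ) : quadForm V Ω (t • u) = t ^ 2 * quadForm V Ω u := by
  -- The expansion along `u + (t - 1) u = t u` avoids a separate discussion of scaling.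
  have h := quadForm_add_smul hV Ω hu hu (t - 1)
  rw [bilinForm_self hu, show u + (t - 1) • u = t • u by rw [sub_smul, one_smul]; abel] at h
  rw [h]
  ring

theorem smul_mem_energySpace (hV : IsTrapping V) {u : Plane → ℂ} (hu : u ∈ energySpace V)
    (t : ℝ) : t • u ∈ energySpace V := by
  have h := add_smul_mem_energySpace hV hu hu (t - 1)
  rwa [show u + (t - 1) • u = t • u by rw [sub_smul, one_smul]; abel] at h

/-! ### The power nonlinearity -/

/-- The power integral `∫ |u|^(p+1)`. -/
noncomputable def powerInt (p : ℝ) (u : Plane → ℂ) : ℝ := ∫ x, ‖u x‖ ^ (p + 1)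

/-- `Re ∫ |u|^(p-1) u φ̄`, which is `1 / (p + 1)` times the derivative of `powerInt p` at `u` in
the direction `φ`. -/
noncomputable def powerForm (p : ℝ) (u φ : Plane → ℂ) : ℝ :=
  ∫ x, ‖u x‖ ^ (p - 1) * (u x * star (φ x)).re

theorem integrable_rpow {p : ℝ} (hp1 : 1 < p) (hp3 : p < 3) {u : Plane → ℂ} (hu : MemH1 u) :
    Integrable fun x => ‖u x‖ ^ (p + 1) := by
  have hm := hu.memLp_rpow (q := p + 1) (by linarith) (by linarith)
  have := hm.integrable_norm_rpow (by simp; linarith) ENNReal.ofReal_ne_top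
  rwa [ENNReal.toReal_ofReal (by linarith)] at this

theorem integrable_norm_add_norm_rpow {p : ℝ} (hp1 : 1 < p) (hp3 : p < 3) {u φ : Plane → ℂ}
    (hu : MemH1 u) (hφ : MemH1 φ) : Integrable fun x => (‖u x‖ + ‖φ x‖) ^ (p + 1) := by
  have h1 := hu.memLp_rpow (q := p + 1) (by linarith) (by linarith)
  have h2 := hφ.memLp_rpow (q := p + 1) (by linarith) (by linarith)
  have := (h1.norm.add h2.norm).integrable_norm_rpow (by simp; linarith) ENNReal.ofReal_ne_top
  rw [ENNReal.toReal_ofReal (by linarith)] at this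
  refine this.congr (Eventually.of_forall fun x => ?_)
  simp only [Pi.add_apply]
  rw [Real.norm_of_nonneg (by positivity)]

theorem rpow_sub_one_mul_le {p a b c d : ℝ} (hp1 : 1 < p) (ha : 0 ≤ a) (hb : 0 ≤ b) (hd : 0 ≤ d)
    (hac : a ≤ c) (hbc : b ≤ c) (hdc : d ≤ c) : a ^ (p - 1) * (b * d) ≤ c ^ (p + 1) := by
  have hc : 0 ≤ c := ha.trans hac
  calc a ^ (p - 1) * (b * d) ≤ c ^ (p - 1) * (c * c) := by
        gcongr
    _ = c ^ (p + 1) := by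
        rw [← pow_two, ← Real.rpow_natCast c 2, ← Real.rpow_add' hc (by push_cast; linarith)]
        congr 1
        push_cast
        ring

theorem integrable_powerForm {p : ℝ} (hp1 : 1 < p) (hp3 : p < 3) {u φ : Plane → ℂ}
    (hu : MemH1 u) (hφ : MemH1 φ) :
    Integrable fun x => ((‖u x‖ ^ (p - 1) : ℝ) : ℂ) * (u x * star (φ x)) := by
  refine (integrable_norm_add_norm_rpow hp1 hp3 hu hφ).mono' ?_ (Eventually.of_forall fun x => ?_)
  · exact (Complex.continuous_ofReal.comp_aestronglyMeasurable
      (hu.1.1.norm.aemeasurable.pow_const _).aestronglyMeasurable).mul (hu.1.1.mul hφ.1.1.star)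
  · rw [norm_mul, norm_mul, norm_star, Complex.norm_real, Real.norm_of_nonneg (by positivity)]
    have h1 := norm_nonneg (u x)
    have h2 := norm_nonneg (φ x)
    exact rpow_sub_one_mul_le hp1 h1 h1 h2 (by linarith) (by linarith) (by linarith)

theorem hasDerivAt_norm_add_smul_rpow {p : ℝ} (hp1 : 1 < p) (z w : ℂ) (t : ℝ) :
    HasDerivAt (fun s : ℝ => ‖z + s • w‖ ^ (p + 1))
      ((p + 1) * (‖z + t • w‖ ^ (p - 1) * ((z + t • w) * star w).re)) t := by
  have h1 : HasDerivAt (fun s : ℝ => z + s • w) w t := by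
    simpa using ((hasDerivAt_id t).smul_const w).const_add z
  have h2 := (hasFDerivAt_norm_rpow (z + t • w) (p := p + 1) (by linarith)).comp_hasDerivAt t h1
  refine h2.congr_deriv ?_
  rw [show p + 1 - 2 = p - 1 by ring]
  simp only [smul_apply, innerSL_apply_apply, Complex.inner, smul_eq_mul]
  rw [mul_assoc]
  congr 2
  simp only [Complex.mul_re, Complex.conj_re, Complex.conj_im, Complex.star_def]
  ring

/-- Differentiation under the integral sign; for `|t| ≤ 1` the derivative of the integrand is
dominated by `(p + 1) (|u| + |φ|)^(p+1)`. -/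
theorem hasDerivAt_powerInt {p : ℝ} (hp1 : 1 < p) (hp3 : p < 3) {u φ : Plane → ℂ}
    (hu : MemH1 u) (hφ : MemH1 φ) :
    HasDerivAt (fun t : ℝ => powerInt p (u + t • φ)) ((p + 1) * powerForm p u φ) 0 := by
  have hm : ∀ t : ℝ, AEStronglyMeasurable (fun x => u x + t • φ x) := fun t =>
    hu.1.1.add (hφ.1.1.const_smul t)
  have h := hasDerivAt_integral_of_dominated_loc_of_deriv_le (μ := (volume : Measure Plane))
    (F := fun (t : ℝ) x => ‖u x + t • φ x‖ ^ (p + 1)) (x₀ := 0) (s := Metric.ball 0 1)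
    (F' := fun (t : ℝ) x =>
      (p + 1) * (‖u x + t • φ x‖ ^ (p - 1) * ((u x + t • φ x) * star (φ x)).re))
    (bound := fun x => (p + 1) * (‖u x‖ + ‖φ x‖) ^ (p + 1))
    (Metric.ball_mem_nhds 0 one_pos)
    (Eventually.of_forall fun t => ((hm t).norm.aemeasurable.pow_const _).aestronglyMeasurable)
    (by simpa using integrable_rpow hp1 hp3 hu)
    (((((hm 0).norm.aemeasurable.pow_const _).aestronglyMeasurable).mul
      (Complex.continuous_re.comp_aestronglyMeasurable ((hm 0).mul hφ.1.1.star))).const_mul _)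
    (Eventually.of_forall fun x t ht => ?_)
    ((integrable_norm_add_norm_rpow hp1 hp3 hu hφ).const_mul _)
    (Eventually.of_forall fun x t _ => hasDerivAt_norm_add_smul_rpow hp1 _ _ t)
  · refine h.2.congr_deriv ?_
    simp [powerForm, integral_const_mul]
  · have ht1 : ‖t‖ ≤ 1 := by
      rw [Metric.mem_ball, dist_zero_right] at ht
      exact ht.le
    have h1 := norm_nonneg (u x)
    have h2 := norm_nonneg (φ x)
    have h3 : ‖u x + t • φ x‖ ≤ ‖u x‖ + ‖φ x‖ := by
      refine (norm_add_le _ _).trans ?_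
      rw [norm_smul]
      gcongr
      exact mul_le_of_le_one_left h2 ht1
    rw [norm_mul, norm_mul, Real.norm_of_nonneg (by linarith),
      Real.norm_of_nonneg (Real.rpow_nonneg (norm_nonneg _) _)]
    refine mul_le_mul_of_nonneg_left ?_ (by linarith)
    refine le_trans (mul_le_mul_of_nonneg_left ((Complex.abs_re_le_norm _).trans_eq ?_)
      (by positivity)) (rpow_sub_one_mul_le hp1 (norm_nonneg _) (norm_nonneg (u x + t • φ x)) h2 h3
        h3 (by linarith))
    rw [norm_mul, norm_star]

theorem powerInt_smul {p : ℝ} (s : ℝ) (hs : 0 ≤ s) (u : Plane → ℂ) :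
    powerInt p (s • u) = s ^ (p + 1) * powerInt p u := by
  simp only [powerInt, Pi.smul_apply, norm_smul, Real.norm_of_nonneg hs,
    Real.mul_rpow hs (norm_nonneg _), integral_const_mul]

theorem powerForm_self {p : ℝ} (hp1 : 1 < p) (u : Plane → ℂ) :
    powerForm p u u = powerInt p u := by
  refine integral_congr_ae (Eventually.of_forall fun x => ?_)
  simp only [mul_star_self_re]
  rw [← Real.rpow_natCast _ 2, ← Real.rpow_add' (norm_nonneg _) (by push_cast; linarith)]
  congr 1
  push_cast
  ring

theorem massForm_self (u : Plane → ℂ) : massForm u u = mass u := by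
  simp only [massForm, mass, mul_star_self_re]

theorem powerInt_pos {p : ℝ} (hp1 : 1 < p) (hp3 : p < 3) {u : Plane → ℂ} (hu : MemH1 u)
    (h0 : ¬ u =ᵐ[volume] 0) : 0 < powerInt p u := by
  have hnn : ∀ x, 0 ≤ ‖u x‖ ^ (p + 1) := fun x => by positivity
  refine lt_of_le_of_ne (integral_nonneg hnn) fun h => h0 ?_
  have := (integral_eq_zero_iff_of_nonneg hnn (integrable_rpow hp1 hp3 hu)).1 h.symm
  filter_upwards [this] with x hx
  have := (Real.rpow_eq_zero (norm_nonneg (u x)) (by linarith)).1 hx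
  simpa using this

theorem mass_pos {u : Plane → ℂ} (hu : MemLp u 2) (h0 : ¬ u =ᵐ[volume] 0) : 0 < mass u := by
  have hnn : ∀ x, 0 ≤ ‖u x‖ ^ 2 := fun x => by positivity
  refine lt_of_le_of_ne (integral_nonneg hnn) fun h => h0 ?_
  filter_upwards [(integral_eq_zero_iff_of_nonneg hnn (integrable_normSq hu)).1 h.symm] with x hx
  simpa using hx

variable {p Ω ρ μ : ℝ}

/-! ### The action along rays and the Euler-Lagrange equation -/

theorem energy_eq (u : Plane → ℂ) : energy V p Ω ρ u
    = quadForm V Ω u - 2 * ρ ^ (p - 1) / (p + 1) * powerInt p u := by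
  simp only [energy, quadForm, powerInt]
  ring

theorem action_eq {u : Plane → ℂ} (hu : u ∈ energySpace V) : action V p Ω ρ μ u
    = energy V p Ω ρ u - μ * mass u := by
  have h1 : ∫ x, (gradSq u x + (V x - μ) * ‖u x‖ ^ 2)
      = (∫ x, (gradSq u x + V x * ‖u x‖ ^ 2)) - μ * ∫ x, ‖u x‖ ^ 2 := by
    have i1 : Integrable fun x => gradSq u x + V x * ‖u x‖ ^ 2 := (integrable_gradSq hu.1).add hu.2
    rw [← integral_const_mul, ← integral_sub i1 ((integrable_normSq hu.1.1).const_mul μ)]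
    refine integral_congr_ae (Eventually.of_forall fun x => ?_)
    simp only
    ring
  rw [action, energy, h1, mass]
  ring

theorem actionDeriv_eq (hV : IsTrapping V) (hp1 : 1 < p) (hp3 : p < 3) {u φ : Plane → ℂ}
    (hu : u ∈ energySpace V) (hφ : φ ∈ energySpace V) : actionDeriv V p Ω ρ μ u φ
      = 2 * (bilinForm V Ω u φ - μ * massForm u φ - ρ ^ (p - 1) * powerForm p u φ) := by
  have re_int : ∀ {f : Plane → ℂ}, Integrable f → (∫ x, f x).re = ∫ x, (f x).re := fun hf =>
    (integral_re hf).symm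
  have i1 := integrable_gradPairing hu.1 hφ.1
  have i2 := integrable_potential_mul_star hV hu hφ
  have i3 := integrable_mul_star hu.1.1 hφ.1.1
  have i4 := integrable_rotDeriv_mul_star hV hu.1 hφ
  have i5 := integrable_powerForm hp1 hp3 hu.1 hφ.1
  have e1 : (∫ x, (gradPairing u φ x + ((V x - μ : ℝ) : ℂ) * u x * star (φ x)))
      = (∫ x, gradPairing u φ x) + (∫ x, (V x : ℂ) * (u x * star (φ x)))
        - μ * ∫ x, u x * star (φ x) := by
    have i12 : Integrable fun x => gradPairing u φ x + (V x : ℂ) * (u x * star (φ x)) := i1.add i2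
    rw [← integral_const_mul, ← integral_add i1 i2, ← integral_sub i12 (i3.const_mul _)]
    refine integral_congr_ae (Eventually.of_forall fun x => ?_)
    simp only
    push_cast
    ring
  have e2 : (∫ x, ((‖u x‖ ^ (p - 1) : ℝ) : ℂ) * u x * star (φ x))
      = ∫ x, ((‖u x‖ ^ (p - 1) : ℝ) : ℂ) * (u x * star (φ x)) := by
    simp only [mul_assoc]
  have e3 : (∫ x, Complex.I * (Ω : ℂ) * rotDeriv u x * star (φ x))
      = Complex.I * (Ω : ℂ) * ∫ x, rotDeriv u x * star (φ x) := by
    rw [← integral_const_mul]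
    simp only [mul_assoc]
  have e4 : (∫ x, rotDeriv u x * star (φ x)).im = ∫ x, (rotDeriv u x * star (φ x)).im :=
    (integral_im i4).symm
  rw [actionDeriv, e1, e2, e3]
  simp only [Complex.add_re, Complex.sub_re, Complex.re_ofReal_mul, re_int i1, re_int i2,
    re_int i3, re_int i5, mul_assoc, Complex.I_mul_re, Complex.im_ofReal_mul, e4]
  rw [bilinForm, massForm, powerForm]
  ring

/-- The function `s ↦ s² - 2 s^q / q` attains its maximum over `s > 0` only at `s = 1`. -/
theorem sq_sub_rpow_lt {q s : ℝ} (hq : 2 < q) (hs : 0 < s) (hs1 : s ≠ 1) :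
    s ^ 2 - 2 / q * s ^ q < 1 - 2 / q := by
  have h0 : s ^ 2 - 1 ≠ 0 := by
    intro h
    apply hs1
    nlinarith
  -- Bernoulli's inequality for `s^q = (1 + (s² - 1))^(q/2)`.
  have h := one_add_mul_self_lt_rpow_one_add (s := s ^ 2 - 1) (by nlinarith) h0
    (p := q / 2) (by linarith)
  rw [add_sub_cancel, ← Real.rpow_natCast s 2, ← Real.rpow_mul hs.le,
    show ((2 : ℕ) : ℝ) * (q / 2) = q by push_cast; ring, Real.rpow_natCast] at h
  have hq0 : 0 < 2 / q := by positivity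
  have := mul_lt_mul_of_pos_left h hq0
  have e : 2 / q * (1 + q / 2 * (s ^ 2 - 1)) = 2 / q + (s ^ 2 - 1) := by
    field_simp
  linarith

/-- Along the ray through a nontrivial critical point, the action is maximal exactly at the
critical point. -/
theorem action_smul_lt (hV : IsTrapping V) (hp1 : 1 < p) (hp3 : p < 3) (hρ : 0 < ρ)
    {v : Plane → ℂ} (hv : v ∈ criticalPoints V p Ω ρ μ) {s : ℝ} (hs : 0 < s) (hs1 : s ≠ 1) :
    action V p Ω ρ μ (s • v) < action V p Ω ρ μ v := by
  obtain ⟨hvV, hv0, hcrit⟩ := hv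
  -- testing the equation with `v` itself
  have htest : quadForm V Ω v - μ * mass v = ρ ^ (p - 1) * powerInt p v := by
    have := hcrit v hvV
    rw [actionDeriv_eq hV hp1 hp3 hvV hvV, bilinForm_self hvV, massForm_self,
      powerForm_self hp1] at this
    linarith
  have hpos : 0 < ρ ^ (p - 1) * powerInt p v :=
    mul_pos (Real.rpow_pos_of_pos hρ _) (powerInt_pos hp1 hp3 hvV.1 hv0)
  have h := mul_lt_mul_of_pos_left
    (sq_sub_rpow_lt (q := p + 1) (by linarith) hs hs1) hpos
  rw [action_eq hvV, action_eq (smul_mem_energySpace hV hvV s), energy_eq, energy_eq,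
    quadForm_smul hV Ω hvV, mass_smul, powerInt_smul s hs.le]
  have e1 : s ^ 2 * quadForm V Ω v
      - 2 * ρ ^ (p - 1) / (p + 1) * (s ^ (p + 1) * powerInt p v) - μ * (s ^ 2 * mass v)
      = ρ ^ (p - 1) * powerInt p v * (s ^ 2 - 2 / (p + 1) * s ^ (p + 1)) := by
    linear_combination s ^ 2 * htest
  have e2 : quadForm V Ω v - 2 * ρ ^ (p - 1) / (p + 1) * powerInt p v - μ * mass v
      = ρ ^ (p - 1) * powerInt p v * (1 - 2 / (p + 1)) := by
    linear_combination htest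
  rw [e1, e2]
  exact h

theorem normalize_mem_unitMass (hV : IsTrapping V) {v : Plane → ℂ} (hv : v ∈ energySpace V)
    (hm : 0 < mass v) : mass v ^ (-(1 / 2) : ℝ) • v ∈ unitMass V := by
  refine ⟨smul_mem_energySpace hV hv _, ?_⟩
  change mass (mass v ^ (-(1 / 2) : ℝ) • v) = 1
  rw [mass_smul, ← Real.rpow_natCast, ← Real.rpow_mul hm.le]
  norm_num
  rw [Real.rpow_neg_one, inv_mul_cancel₀ hm.ne']

/-- The Euler-Lagrange equation of a minimizer, with an explicit Lagrange multiplier. -/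
theorem IsMinimizer.mem_criticalPoints (hV : IsTrapping V) (hp1 : 1 < p) (hp3 : p < 3)
    {u : Plane → ℂ} (hu : IsMinimizer V p Ω ρ u) :
    u ∈ criticalPoints V p Ω ρ (quadForm V Ω u - ρ ^ (p - 1) * powerInt p u) := by
  obtain ⟨⟨huV, hu1⟩, hmin⟩ := hu
  have hu1 : mass u = 1 := hu1
  refine ⟨huV, fun h => ?_, fun φ hφ => ?_⟩
  · have : mass u = 0 := by
      rw [mass, ← integral_zero Plane ℝ (μ := volume)]
      refine integral_congr_ae ?_
      filter_upwards [h] with x hx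
      simp [hx]
    linarith
  rw [actionDeriv_eq hV hp1 hp3 huV hφ]
  have hM : HasDerivAt (fun t : ℝ => mass (u + t • φ)) (2 * massForm u φ) 0 := by
    simp only [mass_add_smul huV.1.1 hφ.1.1]
    have h1 := (((hasDerivAt_id (0 : ℝ)).const_mul 2).mul_const (massForm u φ)).const_add (mass u)
    have h2 := ((hasDerivAt_id (0 : ℝ)).pow 2).mul_const (mass φ)
    refine (h1.add h2).congr_deriv ?_
    simp
  have hQ : HasDerivAt (fun t : ℝ => quadForm V Ω (u + t • φ)) (2 * bilinForm V Ω u φ) 0 := by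
    simp only [quadForm_add_smul hV Ω huV hφ]
    have h1 := (((hasDerivAt_id (0 : ℝ)).const_mul 2).mul_const
      (bilinForm V Ω u φ)).const_add (quadForm V Ω u)
    have h2 := ((hasDerivAt_id (0 : ℝ)).pow 2).mul_const (quadForm V Ω φ)
    refine (h1.add h2).congr_deriv ?_
    simp
  have hP := hasDerivAt_powerInt hp1 hp3 huV.1 hφ.1
  have hM0 : mass (u + (0 : ℝ) • φ) = 1 := by simpa using hu1
  -- the normalizing factor along the line `u + t φ`
  have hS : HasDerivAt (fun t : ℝ => mass (u + t • φ) ^ (-(1 / 2) : ℝ)) (-massForm u φ) 0 := by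
    refine (hM.rpow_const (Or.inl (by rw [hM0]; exact one_ne_zero))).congr_deriv ?_
    rw [hM0, Real.one_rpow]
    ring
  have hS0 : mass (u + (0 : ℝ) • φ) ^ (-(1 / 2) : ℝ) = 1 := by rw [hM0, Real.one_rpow]
  -- The energy of the normalization of `u + t φ`.
  have hE : HasDerivAt (fun t : ℝ =>
      (mass (u + t • φ) ^ (-(1 / 2) : ℝ)) ^ 2 * quadForm V Ω (u + t • φ)
        - 2 * ρ ^ (p - 1) / (p + 1) *
          ((mass (u + t • φ) ^ (-(1 / 2) : ℝ)) ^ (p + 1) * powerInt p (u + t • φ)))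
      (2 * (bilinForm V Ω u φ - (quadForm V Ω u - ρ ^ (p - 1) * powerInt p u) * massForm u φ
        - ρ ^ (p - 1) * powerForm p u φ)) 0 := by
    refine (((hS.pow 2).mul hQ).sub (((hS.rpow_const (p := p + 1) (Or.inl (by
      rw [hS0]; exact one_ne_zero))).mul hP).const_mul _)).congr_deriv ?_
    simp only [Pi.pow_apply, zero_smul, add_zero, hu1, Real.one_rpow]
    have : p + 1 ≠ 0 := by linarith
    field_simp
    ring
  have hloc : IsLocalMin (fun t : ℝ =>
      (mass (u + t • φ) ^ (-(1 / 2) : ℝ)) ^ 2 * quadForm V Ω (u + t • φ)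
        - 2 * ρ ^ (p - 1) / (p + 1) *
          ((mass (u + t • φ) ^ (-(1 / 2) : ℝ)) ^ (p + 1) * powerInt p (u + t • φ))) 0 := by
    have hev : ∀ᶠ t in 𝓝 (0 : ℝ), 0 < mass (u + t • φ) :=
      hM.continuousAt.eventually_const_lt (by simp [hu1])
    filter_upwards [hev] with t ht
    have hw := add_smul_mem_energySpace hV huV hφ t
    have h := isMinOn_iff.1 hmin _ (normalize_mem_unitMass hV hw ht)
    rw [energy_eq, energy_eq, quadForm_smul hV Ω hw, powerInt_smul _ (by positivity)] at h
    simpa only [zero_smul, add_zero, hu1, Real.one_rpow, one_pow, one_mul] using h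
  exact hloc.hasDerivAt_eq_zero hE

/-- A minimizer of `I(ρ)` has at most the action of any critical point `v`: compare with the
normalization of `v` in the energy, and use that the action on the ray through `v` is maximal
at `v`. The inequality is strict if `v` is not normalized. -/
theorem action_le_of_isMinimizer (hV : IsTrapping V) (hp1 : 1 < p) (hp3 : p < 3) (hρ : 0 < ρ)
    {u v : Plane → ℂ} (hu : IsMinimizer V p Ω ρ u) (hv : v ∈ criticalPoints V p Ω ρ μ) :
    action V p Ω ρ μ u ≤ action V p Ω ρ μ v ∧
      (mass v ≠ 1 → action V p Ω ρ μ u < action V p Ω ρ μ v) := by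
  have hm : 0 < mass v := mass_pos hv.1.1.1 hv.2.1
  have hw := normalize_mem_unitMass hV hv.1 hm
  have hwm : mass (mass v ^ (-(1 / 2) : ℝ) • v) = 1 := hw.2
  have hum : mass u = 1 := hu.1.2
  have h1 : action V p Ω ρ μ u ≤ action V p Ω ρ μ (mass v ^ (-(1 / 2) : ℝ) • v) := by
    rw [action_eq hu.1.1, action_eq hw.1, hwm, hum]
    exact sub_le_sub_right (isMinOn_iff.1 hu.2 _ hw) _
  by_cases hv1 : mass v = 1
  · rw [hv1, Real.one_rpow, one_smul] at h1
    exact ⟨h1, fun h => absurd hv1 h⟩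
  · have h2 := action_smul_lt hV hp1 hp3 hρ hv (s := mass v ^ (-(1 / 2) : ℝ)) (by positivity)
      (fun h => hv1 (by
        rw [h, one_smul] at hwm
        exact hwm))
    exact ⟨h1.trans h2.le, fun _ => h1.trans_lt h2⟩

end RotNLS

theorem theoremA1 (V : RotNLS.Plane → ℝ) (hV : RotNLS.IsTrapping V)
    (p : ℝ) (hp1 : 1 < p) (hp3 : p < 3) (ρ : ℝ) (hρ : 0 < ρ)
    (Ω : ℝ) (hΩ : 0 < Ω) (hΩc : (Ω : EReal) < RotNLS.criticalSpeed V) :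
    (∀ u : RotNLS.Plane → ℂ, RotNLS.IsMinimizer V p Ω ρ u →
      ∃ μ : ℝ, u ∈ RotNLS.groundStates V p Ω ρ μ) ∧
    (∀ μ : ℝ, RotNLS.IsChemicalPotential V p Ω ρ μ →
      ∀ u ∈ RotNLS.groundStates V p Ω ρ μ, RotNLS.IsMinimizer V p Ω ρ u) := by
  open RotNLS in
  refine ⟨fun u hu => ⟨_, hu.mem_criticalPoints hV hp1 hp3, fun v hv =>
    (action_le_of_isMinimizer hV hp1 hp3 hρ hu hv).1⟩, ?_⟩
  rintro μ ⟨u, hu, hucrit⟩ v ⟨hv, hvmin⟩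
  have hle := action_le_of_isMinimizer hV hp1 hp3 hρ hu hv
  have hvm : mass v = 1 := by
    by_contra h
    exact absurd (hvmin u hucrit) (not_le.2 (hle.2 h))
  refine ⟨⟨hv.1, hvm⟩, isMinOn_iff.2 fun w hw => ?_⟩
  have hum : mass u = 1 := hu.1.2
  have h1 := hvmin u hucrit
  rw [action_eq hv.1, action_eq hu.1.1, hvm, hum] at h1
  have h2 := isMinOn_iff.1 hu.2 w hw
  linarith
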